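/- A triangulation is a maximal simple planar graph. Given a plane (combinatorial) embedding of it, an edge flip removes an edge $ab$, adjacent to the two triangular faces $abc$ and $abd$, and inserts the other diagonal $cd$ of the resulting quadrilateral, provided that $c\neq d$ and $cd$ is not already an edge. A separating triangle is a cycle of length three whose removal leaves exactly two (non-empty) connected components. A graph is $4$-connected if it has more than four vertices and stays connected after the removal of any at most three vertices. Sierpiński-like triangulations are constructed as follows. Start with a triangle. A recursive step inserts an inverted triangle $m_0m_1m_2$ into the interior of a triangle $c_0c_1c_2$ and joins each $m_i$ to the two corners other than $c_i$; the recursion continues in the three new triangles $c_i m_j m_k$ ($\{i,j,k\}=\{0,1,2\}$) that share an edge with the inserted triangle, but not in $m_0m_1m_2$ itself. Carry out $k\ge 0$ full levels of recursion, and then one further recursive step in an arbitrary subset of the remaining triangles. Finally, add one vertex in the interior of each triangle in which the recursion stops and join it to the three corners of that triangle; also add one vertex in the exterior face and join it to the three corners of the original triangle. **Theorem.** Let $n$ be a positive multiple of $5$. Then $\frac{3n-10}{5}=\left\lfloor\frac{3n-9}{5}\right\rfloor$, and there is a Sierpiński-like graph $T$ on $n$ vertices which is a triangulation, has a family of $\frac{3n-10}{5}$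 pairwise edge-disjoint separating triangles, and requires at least $\frac{3n-10}{5}$ flips to be made $4$-connected: every sequence of edge flips that transforms $T$ into a $4$-connected graph consists of at least $\frac{3n-10}{5}$ flips. (So an upper bound of $\lfloor (3n-9)/5\rfloor$ on the number of flips that suffice to make every $n$-vertex triangulation, $n\ge 6$, $4$-connected cannot be improved for these $n$.) -/

import Mathlib

/-! ### Planar graphs, triangulations and combinatorial embeddings -/

/-- A combinatorial embedding (rotation system) of a graph: the clockwise order of the edges around
each vertex.  A dart `(u, v)` is the edge `uv` seen from `u`; `next` sends it to the dart that
follows it in the order around `u`, and all darts at `u` form one single cycle. -/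
structure RotationSystem {V : Type*} (G : SimpleGraph V) where
  next : Equiv.Perm G.Dart
  next_fst : ∀ d : G.Dart, (next d).fst = d.fst
  sameCycle : ∀ d e : G.Dart, d.fst = e.fst → next.SameCycle d e

namespace RotationSystem

variable {V : Type*} {G : SimpleGraph V}

/-- The reversal `(u, v) ↦ (v, u)` of darts. -/
def reversal (G : SimpleGraph V) : Equiv.Perm G.Dart :=
  Function.Involutive.toPerm SimpleGraph.Dart.symm SimpleGraph.Dart.symm_involutive

/-- Walking along the boundary of a face: having traversed the dart `(u, v)`, continue with the
dart that follows `(v, u)` in the order around `v`.  The faces are the cycles of this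
permutation. -/
def faceStep (R : RotationSystem G) : Equiv.Perm G.Dart :=
  (reversal G).trans R.next

/-- The number of faces, counted separately for every connected component: the number of cycles of
`faceStep`, plus one for every isolated vertex (which carries no dart, but lies in a face). -/
noncomputable def numFaces (R : RotationSystem G) : ℕ :=
  Nat.card (Quotient (Equiv.Perm.SameCycle.setoid R.faceStep)) +
    Nat.card {v : V // ∀ w, ¬ G.Adj v w}

/-- The embedding is plane (every component has genus `0`).  By Euler's formula
`|V| - |E| + |F| = 2 - 2 * genus` for each component, and the genus is nonnegative, so this can be
expressed by summing over the components. -/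
def IsPlane (R : RotationSystem G) : Prop :=
  (Nat.card V : ℤ) - (Nat.card G.edgeSet : ℤ) + (R.numFaces : ℤ) =
    2 * (Nat.card G.ConnectedComponent : ℤ)

/-- The triangle with consecutive corners `a`, `b`, `c` is a face of the embedding, and it is the
face whose boundary walk uses the edge `ab` in the direction from `a` to `b`. -/
def IsTriangularFace (R : RotationSystem G) (a b c : V) : Prop :=
  ∃ d₁ d₂ d₃ : G.Dart, d₁.toProd = (a, b) ∧ d₂.toProd = (b, c) ∧ d₃.toProd = (c, a) ∧
    R.faceStep d₁ = d₂ ∧ R.faceStep d₂ = d₃ ∧ R.faceStep d₃ = d₁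

end RotationSystem

/-- A finite graph is planar if it has a plane combinatorial embedding. -/
def IsPlanar {V : Type*} [Finite V] (G : SimpleGraph V) : Prop :=
  ∃ R : RotationSystem G, R.IsPlane

/-- A triangulation is a maximal simple planar graph. -/
def IsTriangulation {V : Type*} [Finite V] (G : SimpleGraph V) : Prop :=
  IsPlanar G ∧ ∀ H : SimpleGraph V, G < H → ¬ IsPlanar H

/-! ### Flips -/

/-- `H` arises from the triangulation `G` by one edge flip: the edge `ab` is adjacent to the two
faces `abc` and `abd` (one on each side of it), it is deleted, and the other diagonal `cd` of the
resulting quadrilateral is inserted, where `cd` was not an edge before.  (On at least four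
vertices the plane embedding of a triangulation is unique up to reflection, so it is immaterial
which plane embedding is used.) -/
def IsFlip {V : Type*} [Finite V] (G H : SimpleGraph V) : Prop :=
  IsTriangulation G ∧ IsTriangulation H ∧
    ∃ R : RotationSystem G, R.IsPlane ∧
      ∃ a b c d : V, R.IsTriangularFace a b c ∧ R.IsTriangularFace b a d ∧
        c ≠ d ∧ ¬ G.Adj c d ∧ H = G.deleteEdges {s(a, b)} ⊔ SimpleGraph.edge c d

/-- `G` can be transformed into `H` by a sequence of exactly `k` flips. -/
def FlipsTo {V : Type*} [Finite V] (k : ℕ) (G H : SimpleGraph V) : Prop :=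
  ∃ f : ℕ → SimpleGraph V, f 0 = G ∧ f k = H ∧ ∀ i < k, IsFlip (f i) (f (i + 1))

/-! ### Connectivity and separating triangles -/

/-- `k`-connectivity: more than `k` vertices, and connected after the removal of any set of fewer
than `k` vertices. -/
def IsVertexConnected {V : Type*} (k : ℕ) (G : SimpleGraph V) : Prop :=
  k < Nat.card V ∧ ∀ S : Finset V, S.card < k → (G.induce (S : Set V)ᶜ).Connected

/-- A separating triangle, given by its vertex set: a cycle of length three whose removal leaves
exactly two (nonempty) connected components. -/
def IsSeparatingTriangle {V : Type*} (G : SimpleGraph V) (D : Finset V) : Prop :=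
  G.IsNClique 3 D ∧ Nat.card (G.induce (D : Set V)ᶜ).ConnectedComponent = 2

/-- The edges of the triangle with vertex set `D`. -/
def triangleEdges {V : Type*} (G : SimpleGraph V) (D : Finset V) : Set (Sym2 V) :=
  {e | e ∈ G.edgeSet ∧ ∀ v ∈ e, v ∈ D}

/-! ### The Sierpiński-like triangulations -/

/-- The pattern of a recursive subdivision: a `leaf` is a triangle in which the recursion stops, a
`node` is a triangle into which an inverted triangle is inserted, followed by the patterns of the
three corner triangles of the subdivision. -/
inductive SierpinskiTree : Type
  | leaf : SierpinskiTree
  | node : (Fin 3 → SierpinskiTree) → SierpinskiTree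

namespace SierpinskiTree

/-- The pattern consists of `k` full levels of recursion, after which one further step may have been
made in an arbitrary subset of the remaining triangles. -/
def HasLevels : ℕ → SierpinskiTree → Prop
  | 0, leaf => True
  | 0, node c => ∀ i, c i = leaf
  | _ + 1, leaf => False
  | k + 1, node c => ∀ i, HasLevels k (c i)

/-- The vertices in the interior of the subdivided triangle: a single vertex if the recursion stops;
otherwise the three vertices of the inverted triangle and the interior vertices of the three
corner triangles. -/
def Interior : SierpinskiTree → Type
  | leaf => Unit
  | node c => Fin 3 ⊕ (Σ i, (c i).Interior)

/-- All vertices of the subdivided triangle: its three corners `Sum.inl i` and the interior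
vertices. -/
abbrev Disk (t : SierpinskiTree) : Type := Fin 3 ⊕ t.Interior

/-- The position of the `i`-th corner triangle in a subdivided triangle with corners `cᵢ` and
inserted triangle `m₀ m₁ m₂`, where `mⱼ` is joined to the two corners other than `cⱼ`: its
`i`-th corner is `cᵢ`, and its `j`-th corner is `mⱼ` for `j ≠ i`. -/
def place (c : Fin 3 → SierpinskiTree) (i : Fin 3) : (c i).Disk → (node c).Disk
  | Sum.inl j => if j = i then Sum.inl i else (Sum.inr (Sum.inl j) : Fin 3 ⊕ (node c).Interior)
  | Sum.inr x => (Sum.inr (Sum.inr ⟨i, x⟩) : Fin 3 ⊕ (node c).Interior)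

/-- The subdivided triangle.  If the recursion stops, its one interior vertex is joined to the three
corners.  Otherwise it consists of the outer triangle and of the three subdivided corner triangles;
the sides of the corner triangles are the three edges of the inserted triangle and the six edges
that join it to the corners. -/
def diskGraph : (t : SierpinskiTree) → SimpleGraph t.Disk
  | leaf => ⊤
  | node c =>
      (⊤ : SimpleGraph (Fin 3)).map (Sum.inl : Fin 3 → (node c).Disk) ⊔
        ⨆ i, (diskGraph (c i)).map (place c i)

/-- The vertices of the final graph: those of the subdivided triangle, and one vertex `none` in the
exterior face. -/
abbrev Vertex (t : SierpinskiTree) : Type := Option t.Disk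

/-- The Sierpiński-like graph: the subdivided triangle, together with one additional vertex in the
exterior face that is joined to the three corners. -/
def graph (t : SierpinskiTree) : SimpleGraph t.Vertex :=
  t.diskGraph.map some ⊔
    SimpleGraph.fromRel fun x y => x = none ∧ ∃ i : Fin 3, y = some (Sum.inl i)

instance finite_interior : (t : SierpinskiTree) → Finite t.Interior
  | leaf => inferInstanceAs (Finite Unit)
  | node c =>
      have : ∀ i, Finite (c i).Interior := fun i => finite_interior (c i)
      inferInstanceAs (Finite (Fin 3 ⊕ (Σ i, (c i).Interior)))

end SierpinskiTree

/-! Lower bound. A separating triangle is a cut of size three, so a 4-connected graph has none. Let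
a flip replace `ab` by `cd`, and let `D` separate a set `A` from the rest. The new edge can join the
two sides only if both `a` and `b` lie in `D`: each of them is adjacent to both `c` and `d`, so
neither can lie on one side (`SimpleGraph.Cuts.flip`). Hence a flip destroys only cuts that contain
both ends of the removed edge. In a family whose members pairwise share at most one vertex there is
at most one such member, so the number of flips is at least the size of the family
(`FlipsTo.card_le`).

Counting. With `m` inserted triangles the recursion produces `m` subdivided triangles and `2m + 1`
triangles in which it stops. All `3m + 1` of them separate their interior from the exterior vertex
(`IsRegion`), and any two share at most one vertex (`exists_regions`). There are `3m + (2m + 1)`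
interior vertices and four others, so `n = 5m + 5` and `3m + 1 = (3n - 10)/5`. Every `m` occurs
(`exists_hasLevels`).

Triangulation. The faces are built recursively as oriented triangles. Such a system covers each dart
once and has connected vertex links, hence defines a rotation system whose faces are all triangles.
As the graph has `3n - 6` edges, Euler's formula makes it plane. Conversely, a connected plane graph
on `n ≥ 3` vertices has at most `3n - 6` edges, so no edge can be added
(`IsOrientedTriangulation.isTriangulation`). -/

/-! ### Counting the cycles of a permutation -/

/-- A representative of a cycle and its first two images are three distinct elements, so `Fin 3`
times the set of cycles injects into `α`. -/
theorem Equiv.Perm.three_mul_card_cycles_le {α : Type*} [Finite α] (f : Equiv.Perm α)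
    (h1 : ∀ x, f x ≠ x) (h2 : ∀ x, f (f x) ≠ x) :
    3 * Nat.card (Quotient (Equiv.Perm.SameCycle.setoid f)) ≤ Nat.card α := by
  have hinj : Function.Injective
      (fun p : Fin 3 × Quotient (Equiv.Perm.SameCycle.setoid f) => (f ^ (p.1 : ℕ)) p.2.out) := by
    rintro ⟨i, p⟩ ⟨j, q⟩ h
    have hpq : p = q := by
      rw [← Quotient.out_eq p, ← Quotient.out_eq q]
      refine Quotient.sound (?_ : f.SameCycle p.out q.out)
      have h' : f.SameCycle ((f ^ (i : ℕ)) p.out) ((f ^ (j : ℕ)) q.out) := by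
        simp only at h
        rw [h]
      simpa using h'
    subst hpq
    have h12 : ∀ x, f (f x) ≠ f x := fun x => h1 _
    have h21 : ∀ x, f x ≠ f (f x) := fun x => (h1 _).symm
    refine Prod.ext ?_ rfl
    fin_cases i <;> fin_cases j <;>
      simp_all [pow_succ, fun x => (h1 x).symm, fun x => (h2 x).symm]
  have := Nat.card_le_card_of_injective _ hinj
  simpa using this

theorem Equiv.Perm.three_mul_card_cycles_eq {α : Type*} [Finite α] (f : Equiv.Perm α)
    (h1 : ∀ x, f x ≠ x) (h3 : ∀ x, f (f (f x)) = x) :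
    3 * Nat.card (Quotient (Equiv.Perm.SameCycle.setoid f)) = Nat.card α := by
  refine le_antisymm (f.three_mul_card_cycles_le h1 fun x h => h1 x ?_) ?_
  · have h' := h3 x
    rwa [h] at h'
  have hf : f ^ 3 = 1 := by
    ext x
    simp [pow_succ, h3]
  have hsurj : Function.Surjective
      (fun p : Fin 3 × Quotient (Equiv.Perm.SameCycle.setoid f) => (f ^ (p.1 : ℕ)) p.2.out) := by
    intro x
    obtain ⟨i, hi⟩ : f.SameCycle (Quotient.mk (Equiv.Perm.SameCycle.setoid f) x).out x :=
      Quotient.exact (s := Equiv.Perm.SameCycle.setoid f) (Quotient.out_eq _)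
    have h0 : 0 ≤ i % 3 := Int.emod_nonneg _ (by norm_num)
    have h4 : i % 3 < 3 := Int.emod_lt_of_pos _ (by norm_num)
    refine ⟨(⟨(i % 3).toNat, by omega⟩, Quotient.mk _ x), ?_⟩
    have hz : f ^ i = f ^ (i % 3).toNat := by
      rw [← zpow_natCast, Int.toNat_of_nonneg h0]
      conv_lhs => rw [← Int.mul_ediv_add_emod i 3, zpow_add, zpow_mul]
      rw [show f ^ (3 : ℤ) = 1 from by exact_mod_cast hf]
      simp
    rw [hz] at hi
    exact hi
  have := Nat.card_le_card_of_surjective _ hsurj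
  simpa using this

/-! ### Edge bound for plane graphs -/

theorem SimpleGraph.natCard_dart {V : Type*} [Finite V] (G : SimpleGraph V) :
    Nat.card G.Dart = 2 * Nat.card G.edgeSet := by
  classical
  have := Fintype.ofFinite V
  rw [Nat.card_eq_fintype_card, G.dart_card_eq_twice_card_edges, Nat.card_eq_fintype_card,
    SimpleGraph.edgeFinset_card]

theorem SimpleGraph.Connected.natCard_connectedComponent {V : Type*} {G : SimpleGraph V}
    (h : G.Connected) : Nat.card G.ConnectedComponent = 1 := by
  have := h.preconnected.subsingleton_connectedComponent
  have : Nonempty G.ConnectedComponent := h.nonempty.map G.connectedComponentMk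
  exact Nat.card_unique

namespace RotationSystem

variable {V : Type*} {G : SimpleGraph V}

instance finite_dart [Finite V] : Finite G.Dart :=
  Finite.of_injective (fun d : G.Dart => d.toProd) fun _ _ h => SimpleGraph.Dart.ext _ _ h

theorem faceStep_apply (R : RotationSystem G) (d : G.Dart) : R.faceStep d = R.next d.symm := rfl

theorem faceStep_fst (R : RotationSystem G) (d : G.Dart) : (R.faceStep d).fst = d.snd := by
  rw [faceStep_apply, R.next_fst]
  rfl

theorem faceStep_ne (R : RotationSystem G) (d : G.Dart) : R.faceStep d ≠ d := by
  intro h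
  have := R.faceStep_fst d
  rw [h] at this
  exact d.adj.ne this

/-- A dart that is alone around its vertex leads to the only neighbour of that vertex. -/
theorem eq_snd_of_next_eq (R : RotationSystem G) {d : G.Dart} (h : R.next d = d) {w : V}
    (hw : G.Adj d.fst w) : w = d.snd := by
  obtain ⟨i, hi⟩ := R.sameCycle d ⟨(d.fst, w), hw⟩ rfl
  rw [Equiv.Perm.zpow_apply_eq_self_of_apply_eq_self h] at hi
  rw [hi]

/-- In a face of length two both darts are fixed by `next`. Each end then has the other as its only
neighbour, and connectedness leaves no further vertex. -/
theorem faceStep_faceStep_ne [Finite V] (R : RotationSystem G) (hG : G.Connected)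
    (hV : 3 ≤ Nat.card V) (d : G.Dart) : R.faceStep (R.faceStep d) ≠ d := by
  intro h
  have h1 : R.faceStep d = d.symm := by
    refine SimpleGraph.Dart.ext _ _ (Prod.ext (R.faceStep_fst d) ?_)
    have := R.faceStep_fst (R.faceStep d)
    rw [h] at this
    exact this.symm
  have h2 : R.next d.symm = d.symm := h1
  have h3 : R.next d = d := by
    rw [h1, faceStep_apply] at h
    simpa using h
  have hclosed : ∀ x : V, x = d.fst ∨ x = d.snd := by
    intro x
    obtain ⟨p⟩ := hG.preconnected d.fst x
    have key : ∀ {u v : V}, G.Walk u v → (u = d.fst ∨ u = d.snd) → (v = d.fst ∨ v = d.snd) := by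
      intro u v p
      induction p with
      | nil => exact id
      | cons hadj _ ih =>
        intro hu
        refine ih ?_
        rcases hu with rfl | rfl
        · exact Or.inr (R.eq_snd_of_next_eq h3 hadj)
        · exact Or.inl (R.eq_snd_of_next_eq h2 hadj)
    exact key p (Or.inl rfl)
  have hsurj : Function.Surjective (fun b : Bool => if b then d.fst else d.snd) := by
    intro x
    rcases hclosed x with rfl | rfl
    · exact ⟨true, rfl⟩
    · exact ⟨false, rfl⟩
  have := Nat.card_le_card_of_surjective _ hsurj
  simp at this
  omega

theorem card_isolated [Finite V] (hG : G.Connected) (hV : 2 ≤ Nat.card V) :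
    Nat.card {v : V // ∀ w, ¬ G.Adj v w} = 0 := by
  have : Nontrivial V := Finite.one_lt_card_iff_nontrivial.mp hV
  rw [Nat.card_eq_zero]
  left
  refine ⟨fun ⟨v, hv⟩ => ?_⟩
  obtain ⟨w, hw⟩ := hG.preconnected.exists_adj_of_nontrivial v
  exact hv w hw

/-- Euler's formula, combined with the fact that each face uses at least three of the `2 |E|` darts.
-/
theorem IsPlane.card_edgeSet_le [Finite V] {R : RotationSystem G} (hR : R.IsPlane)
    (hG : G.Connected) (hV : 3 ≤ Nat.card V) : Nat.card G.edgeSet + 6 ≤ 3 * Nat.card V := by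
  have h := R.faceStep.three_mul_card_cycles_le R.faceStep_ne (R.faceStep_faceStep_ne hG hV)
  rw [G.natCard_dart] at h
  unfold IsPlane numFaces at hR
  rw [hG.natCard_connectedComponent, card_isolated hG (by omega)] at hR
  push_cast at hR
  omega

end RotationSystem

/-! ### Plane embeddings from oriented triangles -/

/-- The relation `F` lists the oriented triangles of a triangulated closed surface whose edges form
the graph `G`: each dart lies in exactly one of them, and the link of each vertex is connected. -/
structure IsOrientedTriangulation {V : Type*} (G : SimpleGraph V) (F : V → V → V → Prop) :
    Prop where
  rotate : ∀ {a b c}, F a b c → F b c a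
  adj : ∀ {a b c}, F a b c → G.Adj a b
  unique : ∀ {a b c c'}, F a b c → F a b c' → c = c'
  exists_third : ∀ {a b}, G.Adj a b → ∃ c, F a b c
  link : ∀ {v a b}, G.Adj v a → G.Adj v b → Relation.EqvGen (F v) a b

namespace IsOrientedTriangulation

variable {V : Type*} {G : SimpleGraph V} {F : V → V → V → Prop}

/-- The dart that follows `d` in the rotation around its first vertex. -/
noncomputable def nextDart (h : IsOrientedTriangulation G F) (d : G.Dart) : G.Dart :=
  ⟨(d.fst, (h.exists_third d.adj.symm).choose),
    h.adj (h.rotate (h.exists_third d.adj.symm).choose_spec)⟩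

theorem nextDart_spec (h : IsOrientedTriangulation G F) (d : G.Dart) :
    F d.snd d.fst (h.nextDart d).snd :=
  (h.exists_third d.adj.symm).choose_spec

/-- The dart that precedes `d` in the rotation around its first vertex. -/
noncomputable def prevDart (h : IsOrientedTriangulation G F) (d : G.Dart) : G.Dart :=
  ⟨(d.fst, (h.exists_third d.adj).choose),
    (h.adj (h.rotate (h.rotate (h.exists_third d.adj).choose_spec))).symm⟩

theorem prevDart_spec (h : IsOrientedTriangulation G F) (d : G.Dart) :
    F d.fst d.snd (h.prevDart d).snd :=
  (h.exists_third d.adj).choose_spec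

/-- The rotation around the vertices of a triangulated surface. -/
noncomputable def next (h : IsOrientedTriangulation G F) : Equiv.Perm G.Dart where
  toFun := h.nextDart
  invFun := h.prevDart
  left_inv d := SimpleGraph.Dart.ext _ _ (Prod.ext rfl
    (h.unique (h.prevDart_spec (h.nextDart d)) (h.rotate (h.nextDart_spec d))))
  right_inv d := SimpleGraph.Dart.ext _ _ (Prod.ext rfl
    (h.unique (h.nextDart_spec (h.prevDart d)) (h.rotate (h.rotate (h.prevDart_spec d)))))

theorem next_fst (h : IsOrientedTriangulation G F) (d : G.Dart) : (h.next d).fst = d.fst := rfl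

theorem next_spec (h : IsOrientedTriangulation G F) (d : G.Dart) :
    F d.snd d.fst (h.next d).snd :=
  h.nextDart_spec d

/-- The equivalence of adjacencies is carried along so that, in the transitive case, the
intermediate vertex is known to be a neighbour of `v` and defines a dart. -/
theorem sameCycle_of_link (h : IsOrientedTriangulation G F) {v a b : V}
    (hab : Relation.EqvGen (F v) a b) :
    (G.Adj v a ↔ G.Adj v b) ∧ ∀ (ha : G.Adj v a) (hb : G.Adj v b),
      h.next.SameCycle ⟨(v, a), ha⟩ ⟨(v, b), hb⟩ := by
  induction hab with
  | rel a b hF =>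
    have hb : G.Adj v b := (h.adj (h.rotate (h.rotate hF))).symm
    refine ⟨iff_of_true (h.adj hF) hb, fun ha hb => Equiv.Perm.SameCycle.symm ⟨1, ?_⟩⟩
    refine SimpleGraph.Dart.ext _ _ (Prod.ext rfl ?_)
    exact h.unique (h.next_spec ⟨(v, b), hb⟩) (h.rotate (h.rotate hF))
  | refl a => exact ⟨Iff.rfl, fun _ _ => Equiv.Perm.SameCycle.refl _ _⟩
  | symm a b _ ih => exact ⟨ih.1.symm, fun ha hb => (ih.2 hb ha).symm⟩
  | trans a b c _ _ ih1 ih2 =>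
    exact ⟨ih1.1.trans ih2.1, fun ha hc => (ih1.2 ha (ih1.1.mp ha)).trans (ih2.2 _ hc)⟩

/-- The rotation system of a triangulated surface. -/
noncomputable def rotationSystem (h : IsOrientedTriangulation G F) : RotationSystem G where
  next := h.next
  next_fst := h.next_fst
  sameCycle := by
    rintro ⟨⟨v, a⟩, ha⟩ ⟨⟨v', b⟩, hb⟩ (rfl : v = v')
    exact (h.sameCycle_of_link (h.link ha hb)).2 ha hb

theorem faceStep_spec (h : IsOrientedTriangulation G F) (d : G.Dart) :
    F d.fst d.snd (h.rotationSystem.faceStep d).snd :=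
  h.next_spec d.symm

theorem faceStep_three (h : IsOrientedTriangulation G F) (d : G.Dart) :
    h.rotationSystem.faceStep (h.rotationSystem.faceStep (h.rotationSystem.faceStep d)) = d := by
  set R := h.rotationSystem
  have s0 := h.faceStep_spec d
  have s1 := h.faceStep_spec (R.faceStep d)
  have s2 := h.faceStep_spec (R.faceStep (R.faceStep d))
  have f1 := R.faceStep_fst d
  have f2 := R.faceStep_fst (R.faceStep d)
  have f3 := R.faceStep_fst (R.faceStep (R.faceStep d))
  have e1 : (R.faceStep (R.faceStep d)).snd = d.fst := by
    rw [f1] at s1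
    exact h.unique s1 (h.rotate s0)
  refine SimpleGraph.Dart.ext _ _ (Prod.ext (f3.trans e1) ?_)
  rw [f2, e1] at s2
  exact h.unique s2 (h.rotate (h.rotate s0))

/-- A connected triangulated surface with `3 |V| - 6` edges is a sphere, and its graph is a maximal
planar graph. -/
theorem isTriangulation [Finite V] (h : IsOrientedTriangulation G F) (hG : G.Connected)
    (hV : 3 ≤ Nat.card V) (hE : Nat.card G.edgeSet + 6 = 3 * Nat.card V) : IsTriangulation G := by
  refine ⟨⟨h.rotationSystem, ?_⟩, fun H hH ⟨R, hR⟩ => ?_⟩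
  · have hc := h.rotationSystem.faceStep.three_mul_card_cycles_eq h.rotationSystem.faceStep_ne
      h.faceStep_three
    rw [G.natCard_dart] at hc
    unfold RotationSystem.IsPlane RotationSystem.numFaces
    rw [hG.natCard_connectedComponent, RotationSystem.card_isolated hG (by omega)]
    push_cast
    omega
  · have h1 := hR.card_edgeSet_le (hG.mono hH.le) hV
    have h2 : G.edgeSet.ncard < H.edgeSet.ncard :=
      Set.ncard_lt_ncard (SimpleGraph.edgeSet_ssubset_edgeSet.mpr hH) (Set.toFinite _)
    rw [← Nat.card_coe_set_eq, ← Nat.card_coe_set_eq] at h2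
    omega

end IsOrientedTriangulation

/-! ### Flips and separating triangles -/

/-- The set `D` separates the nonempty set `A` of vertices from the nonempty rest of the graph. -/
structure SimpleGraph.Cuts {V : Type*} (G : SimpleGraph V) (D : Finset V) (A : Set V) : Prop where
  nonempty : A.Nonempty
  disjoint : ∀ a ∈ A, a ∉ D
  rest : ∃ b, b ∉ A ∧ b ∉ D
  closed : ∀ a ∈ A, ∀ x, G.Adj a x → x ∈ A ∨ x ∈ D

theorem SimpleGraph.Cuts.reachable_mem {V : Type*} {G : SimpleGraph V} {D : Finset V} {A : Set V}
    (h : G.Cuts D A) {u v : ((D : Set V)ᶜ : Set V)}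
    (huv : (G.induce (D : Set V)ᶜ).Reachable u v) (hu : u.1 ∈ A) : v.1 ∈ A := by
  obtain ⟨p⟩ := huv
  induction p with
  | nil => exact hu
  | @cons u v w hadj _ ih =>
    refine ih ((h.closed _ hu _ hadj).resolve_right ?_)
    exact fun hv => v.2 (Finset.mem_coe.mpr hv)

theorem SimpleGraph.Cuts.not_connected {V : Type*} {G : SimpleGraph V} {D : Finset V} {A : Set V}
    (h : G.Cuts D A) : ¬ (G.induce (D : Set V)ᶜ).Connected := by
  intro hc
  obtain ⟨a, ha⟩ := h.nonempty
  obtain ⟨b, hb, hbD⟩ := h.rest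
  exact hb (h.reachable_mem (hc.preconnected ⟨a, fun hD => h.disjoint a ha (Finset.mem_coe.mp hD)⟩
    ⟨b, fun hD => hbD (Finset.mem_coe.mp hD)⟩) ha)

/-- A flip that does not remove an edge of the clique `D` leaves `D` a clique that separates the
same vertices. -/
theorem SimpleGraph.Cuts.flip {V : Type*} {G : SimpleGraph V} {D : Finset V} {A : Set V}
    (h : G.Cuts D A) {a b c d : V} (hac : G.Adj a c) (hbc : G.Adj b c)
    (had : G.Adj a d) (hbd : G.Adj b d) (hD : ¬ (a ∈ D ∧ b ∈ D)) :
    (G.deleteEdges {s(a, b)} ⊔ SimpleGraph.edge c d).Cuts D A := by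
  -- If `c` lies in `A` and `d` on the far side, then `a` is a neighbour of both. It is in `A` or
  -- `D` because of `c`, and not in `A` because of `d`. The same holds for `b`, so both would be in
  -- `D`.
  have key : ∀ c d : V, G.Adj a c → G.Adj b c → G.Adj a d → G.Adj b d → c ∈ A → d ∈ A ∨ d ∈ D := by
    intro c d hac hbc had hbd hc
    by_contra! hd
    refine hD ⟨(h.closed c hc a hac.symm).resolve_left fun ha => ?_,
      (h.closed c hc b hbc.symm).resolve_left fun hb => ?_⟩
    · exact (h.closed a ha d had).elim hd.1 hd.2
    · exact (h.closed b hb d hbd).elim hd.1 hd.2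
  refine ⟨h.nonempty, h.disjoint, h.rest, fun u hu x hux => ?_⟩
  rw [SimpleGraph.sup_adj, SimpleGraph.deleteEdges_adj, SimpleGraph.edge_adj] at hux
  rcases hux with hux | ⟨⟨rfl, rfl⟩ | ⟨rfl, rfl⟩, _⟩
  · exact h.closed u hu x hux.1
  · exact key _ _ hac hbc had hbd hu
  · exact key _ _ had hbd hac hbc hu

/-- After `i` flips at least `|𝒟| - i` members still cut the graph. Edge-disjointness is phrased
through common vertices, which makes it independent of the changing graph. -/
theorem FlipsTo.card_le {V : Type*} [Finite V] {G H : SimpleGraph V} {m : ℕ}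
    (hf : FlipsTo m G H) (hH : IsVertexConnected 4 H) (𝒟 : Finset (Finset V))
    (h3 : ∀ D ∈ 𝒟, D.card = 3) (hcut : ∀ D ∈ 𝒟, ∃ A, G.Cuts D A)
    (hdisj : ∀ D ∈ 𝒟, ∀ D' ∈ 𝒟, D ≠ D' → ∀ a ∈ D, ∀ b ∈ D, a ∈ D' → b ∈ D' → a = b) :
    𝒟.card ≤ m := by
  classical
  obtain ⟨f, h0, hm, hstep⟩ := hf
  have key : ∀ i ≤ m, ∃ 𝒮 ⊆ 𝒟, 𝒟.card ≤ 𝒮.card + i ∧ ∀ D ∈ 𝒮, ∃ A, (f i).Cuts D A := by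
    intro i
    induction i with
    | zero => exact fun _ => ⟨𝒟, subset_rfl, le_rfl, h0 ▸ hcut⟩
    | succ i ih =>
      intro hi
      obtain ⟨𝒮, hsub, hcard, hS⟩ := ih (by omega)
      obtain ⟨_, _, R, _, a, b, c, d, hc, hd, _, _, hnew⟩ := hstep i (by omega)
      have adj : ∀ {x y z : V}, R.IsTriangularFace x y z →
          (f i).Adj x y ∧ (f i).Adj y z ∧ (f i).Adj z x := by
        rintro x y z ⟨d₁, d₂, d₃, h₁, h₂, h₃, -⟩
        have a₁ := d₁.adj
        have a₂ := d₂.adj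
        have a₃ := d₃.adj
        simp only [h₁, h₂, h₃] at a₁ a₂ a₃
        exact ⟨a₁, a₂, a₃⟩
      obtain ⟨hab, hbc, hca⟩ := adj hc
      obtain ⟨-, had, hdb⟩ := adj hd
      refine ⟨𝒮.filter fun D => ¬ (a ∈ D ∧ b ∈ D), (Finset.filter_subset _ _).trans hsub, ?_, ?_⟩
      · have h1 : (𝒮.filter fun D => a ∈ D ∧ b ∈ D).card ≤ 1 := by
          refine Finset.card_le_one.mpr fun D hD D' hD' => ?_
          rw [Finset.mem_filter] at hD hD'
          by_contra hne
          exact hab.ne (hdisj D (hsub hD.1) D' (hsub hD'.1) hne a hD.2.1 b hD.2.2 hD'.2.1 hD'.2.2)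
        have h2 := 𝒮.card_filter_add_card_filter_not (fun D => a ∈ D ∧ b ∈ D)
        omega
      · intro D hD
        rw [Finset.mem_filter] at hD
        obtain ⟨A, hA⟩ := hS D hD.1
        rw [hnew]
        exact ⟨A, hA.flip hca.symm hbc had hdb.symm hD.2⟩
  obtain ⟨𝒮, hsub, hcard, hS⟩ := key m le_rfl
  rcases 𝒮.eq_empty_or_nonempty with rfl | ⟨D, hD⟩
  · simpa using hcard
  · obtain ⟨A, hA⟩ := hS D hD
    rw [hm] at hA
    exact absurd (hH.2 D (by rw [h3 D (hsub hD)]; norm_num)) hA.not_connected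

/-! ### The octahedral pattern of one recursive step -/

/-- The octahedron formed by the outer corners `Sum.inl i` and the inserted corners `Sum.inr i`:
`medialCorner i j` is the `j`-th corner of the `i`-th corner triangle. -/
def medialCorner (i j : Fin 3) : Fin 3 ⊕ Fin 3 := if j = i then Sum.inl i else Sum.inr j

/-- The oriented faces of a recursive step that are not subdivided further: the inserted triangle
and the three triangles on the sides of the outer triangle. -/
def MedialFace (x y z : Fin 3 ⊕ Fin 3) : Prop :=
  ∃ i : Fin 3, (x = .inr i ∧ y = .inr (i + 1) ∧ z = .inr (i + 2)) ∨
    (x = .inl i ∧ y = .inl (i + 1) ∧ z = .inr (i + 2)) ∨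
    (x = .inl (i + 1) ∧ y = .inr (i + 2) ∧ z = .inl i) ∨
    (x = .inr (i + 2) ∧ y = .inl i ∧ z = .inl (i + 1))

namespace MedialFace

instance (x y z : Fin 3 ⊕ Fin 3) : Decidable (MedialFace x y z) := by
  unfold MedialFace
  infer_instance

theorem rotate : ∀ {x y z}, MedialFace x y z → MedialFace y z x := by
  decide

theorem edge : ∀ {x y z}, MedialFace x y z →
    (∃ i, x = .inl i ∧ y = .inl (i + 1)) ∨
      ∃ i j, x = medialCorner i j ∧ y = medialCorner i (j + 1) := by
  decide

theorem unique : ∀ {x y z z'}, MedialFace x y z → MedialFace x y z' → z = z' := by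
  have h : ∀ x y, ∃ w, ∀ z, MedialFace x y z → z = w := by decide
  intro x y z z' h1 h2
  obtain ⟨w, hw⟩ := h x y
  rw [hw z h1, hw z' h2]

theorem exists_outer : ∀ i : Fin 3, ∃ z, MedialFace (.inl i) (.inl (i + 1)) z := by
  decide

theorem exists_corner :
    ∀ i j : Fin 3, ∃ z, MedialFace (medialCorner i j) (medialCorner i (j + 1)) z := by
  decide

/-- The unsubdivided faces run along the sides of a corner triangle only from corner `j` to corner
`j + 1`. This is why the corner triangles are glued in with reversed orientation. -/
theorem corner_eq : ∀ {i j j' : Fin 3} {z},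
    MedialFace (medialCorner i j) (medialCorner i j') z → j' = j + 1 := by
  decide

theorem not_outer : ∀ (i : Fin 3) (z), ¬ MedialFace (.inl (i + 1)) (.inl i) z := by
  decide

end MedialFace

theorem Fin.ne_add_one : ∀ i : Fin 3, i ≠ i + 1 := by
  decide

theorem Fin.three_eq_add_of_ne : ∀ {i j : Fin 3}, i ≠ j → j = i + 1 ∨ i = j + 1 := by
  decide

/-! ### Triangulated disks -/

/-- The relation `F` lists the oriented triangles of a triangulated disk with graph `G` that is
bounded by the triangle with the given corners: every dart lies in exactly one of them, except that
the boundary darts of the reverse orientation lie in none. -/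
structure IsOrientedDisk {V : Type*} (G : SimpleGraph V) (corner : Fin 3 → V)
    (F : V → V → V → Prop) : Prop where
  rotate : ∀ {a b c}, F a b c → F b c a
  adj : ∀ {a b c}, F a b c → G.Adj a b
  unique : ∀ {a b c c'}, F a b c → F a b c' → c = c'
  exists_third : ∀ {a b}, G.Adj a b → (∃ c, F a b c) ∨ ∃ i, a = corner (i + 1) ∧ b = corner i
  boundary : ∀ i x, ¬ F (corner (i + 1)) (corner i) x
  link : ∀ {v a b}, G.Adj v a → G.Adj v b → Relation.EqvGen (F v) a b

namespace SierpinskiTree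

/-- The oriented faces of a triangle with one interior vertex. -/
def LeafFace (x y z : Fin 3 ⊕ Unit) : Prop :=
  ∃ i : Fin 3, (x = .inl i ∧ y = .inl (i + 1) ∧ z = .inr ()) ∨
    (x = .inl (i + 1) ∧ y = .inr () ∧ z = .inl i) ∨
    (x = .inr () ∧ y = .inl i ∧ z = .inl (i + 1))

instance (x y z : Fin 3 ⊕ Unit) : Decidable (LeafFace x y z) := by
  unfold LeafFace
  infer_instance

theorem isOrientedDisk_leafFace :
    IsOrientedDisk (⊤ : SimpleGraph (Fin 3 ⊕ Unit)) Sum.inl LeafFace where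
  rotate := by decide
  adj := by simp only [SimpleGraph.top_adj]; decide
  unique := by decide
  exists_third := by simp only [SimpleGraph.top_adj]; decide
  boundary := by decide
  link := by
    intro v a b ha hb
    rw [SimpleGraph.top_adj] at ha hb
    -- The link of each vertex is a triangle, so any two of its vertices are within one step of a
    -- common one.
    have h : ∀ v a b, v ≠ a → v ≠ b → ∃ w, (a = w ∨ LeafFace v a w ∨ LeafFace v w a) ∧
        (b = w ∨ LeafFace v b w ∨ LeafFace v w b) := by
      decide
    have key : ∀ {a w}, a = w ∨ LeafFace v a w ∨ LeafFace v w a →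
        Relation.EqvGen (LeafFace v) a w := by
      rintro a w (rfl | h | h)
      · exact .refl _
      · exact .rel _ _ h
      · exact .symm _ _ (.rel _ _ h)
    obtain ⟨w, hw, hw'⟩ := h v a b ha hb
    exact .trans _ _ _ (key hw) (.symm _ _ (key hw'))

/-! ### Gluing the corner triangles -/

variable (c : Fin 3 → SierpinskiTree)

/-- The corners of the outer and of the inserted triangle, as vertices of the subdivided triangle. -/
def medial : Fin 3 ⊕ Fin 3 → (node c).Disk
  | Sum.inl i => Sum.inl i
  | Sum.inr i => (Sum.inr (Sum.inl i) : Fin 3 ⊕ (node c).Interior)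

theorem medial_injective : Function.Injective (medial c) := by
  rintro (i | i) (j | j) h
  · exact congrArg Sum.inl (Sum.inl.inj h)
  · cases h
  · cases h
  · exact congrArg Sum.inr (Sum.inl.inj (Sum.inr.inj h))

theorem place_inl (i j : Fin 3) : place c i (Sum.inl j) = medial c (medialCorner i j) := by
  by_cases h : j = i
  · rw [medialCorner, if_pos h]
    exact if_pos h
  · rw [medialCorner, if_neg h]
    exact if_neg h

theorem place_inr (i : Fin 3) (x : (c i).Interior) :
    place c i (Sum.inr x) = (Sum.inr (Sum.inr ⟨i, x⟩) : Fin 3 ⊕ (node c).Interior) := rfl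

theorem medialCorner_injective (i : Fin 3) : Function.Injective (medialCorner i) := by
  revert i
  decide

theorem medial_ne_place_inr (u : Fin 3 ⊕ Fin 3) (i : Fin 3) (x : (c i).Interior) :
    medial c u ≠ place c i (Sum.inr x) := by
  rcases u with u | u <;> intro h <;> cases h

theorem eq_of_place_inr_eq {i : Fin 3} {x : (c i).Interior} {j : Fin 3} {y : (c j).Disk}
    (h : place c i (Sum.inr x) = place c j y) : i = j := by
  rcases y with y | y
  · rw [place_inl] at h
    exact absurd h.symm (medial_ne_place_inr c _ _ _)
  · rw [place_inr, place_inr] at h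
    exact congrArg Sigma.fst (Sum.inr.inj (Sum.inr.inj h))

theorem place_injective (i : Fin 3) : Function.Injective (place c i) := by
  rintro (x | x) (y | y) h
  · rw [place_inl, place_inl] at h
    exact congrArg _ (medialCorner_injective i (medial_injective c h))
  · rw [place_inl] at h
    exact absurd h (medial_ne_place_inr c _ _ _)
  · rw [place_inl] at h
    exact absurd h.symm (medial_ne_place_inr c _ _ _)
  · rw [place_inr, place_inr] at h
    exact congrArg Sum.inr (eq_of_heq (Sigma.mk.inj (Sum.inr.inj (Sum.inr.inj h))).2)

theorem exists_of_medial_eq_place {u : Fin 3 ⊕ Fin 3} {i : Fin 3} {x : (c i).Disk}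
    (h : medial c u = place c i x) : ∃ j, x = Sum.inl j ∧ u = medialCorner i j := by
  rcases x with x | x
  · rw [place_inl] at h
    exact ⟨x, rfl, medial_injective c h⟩
  · exact absurd h (medial_ne_place_inr c _ _ _)

/-- Two different corner triangles have only one vertex in common. -/
theorem eq_of_place_eq_place {i j : Fin 3} (hij : i ≠ j) {x y : (c i).Disk} {x' y' : (c j).Disk}
    (hx : place c i x = place c j x') (hy : place c i y = place c j y') : x = y := by
  rcases x with x | x
  · rcases y with y | y
    · rw [place_inl] at hx hy
      obtain ⟨k, -, hk⟩ := exists_of_medial_eq_place c hx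
      obtain ⟨l, -, hl⟩ := exists_of_medial_eq_place c hy
      have key : ∀ i j x y k l : Fin 3, i ≠ j → medialCorner i x = medialCorner j k →
          medialCorner i y = medialCorner j l → x = y := by decide
      exact congrArg _ (key i j x y k l hij hk hl)
    · exact absurd (eq_of_place_inr_eq c hy) hij
  · exact absurd (eq_of_place_inr_eq c hx) hij

/-- Each corner triangle contains just one outer corner. Hence no edge or face side of a corner
triangle joins two outer corners. -/
theorem place_eq_inl {i k : Fin 3} {x : (c i).Disk} (h : place c i x = Sum.inl k) :
    k = i ∧ x = Sum.inl i := by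
  obtain ⟨j, rfl, hj⟩ := exists_of_medial_eq_place c (u := Sum.inl k) h.symm
  have key : ∀ i j k : Fin 3, Sum.inl k = medialCorner i j → k = i ∧ j = i := by decide
  obtain ⟨h1, h2⟩ := key i j k hj
  exact ⟨h1, congrArg _ h2⟩

theorem eq_medial_or_eq_place (v : (node c).Disk) :
    (∃ u, v = medial c u) ∨ ∃ i, ∃ x : (c i).Interior, v = place c i (Sum.inr x) := by
  rcases v with i | i | ⟨i, x⟩
  · exact Or.inl ⟨Sum.inl i, rfl⟩
  · exact Or.inl ⟨Sum.inr i, rfl⟩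
  · exact Or.inr ⟨i, x, rfl⟩

theorem diskGraph_node_adj {a b : (node c).Disk} : (diskGraph (node c)).Adj a b ↔
    (∃ i j : Fin 3, i ≠ j ∧ a = Sum.inl i ∧ b = Sum.inl j) ∨
      ∃ i u w, (diskGraph (c i)).Adj u w ∧ place c i u = a ∧ place c i w = b := by
  simp only [diskGraph, SimpleGraph.sup_adj, SimpleGraph.iSup_adj, SimpleGraph.map_adj']
  constructor
  · rintro (⟨-, i, j, h, rfl, rfl⟩ | ⟨i, -, u, w, h, rfl, rfl⟩)
    · exact Or.inl ⟨i, j, h, rfl, rfl⟩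
    · exact Or.inr ⟨i, u, w, h, rfl, rfl⟩
  · rintro (⟨i, j, h, rfl, rfl⟩ | ⟨i, u, w, h, rfl, rfl⟩)
    · exact Or.inl ⟨Sum.inl_injective.ne h, i, j, h, rfl, rfl⟩
    · exact Or.inr ⟨i, (place_injective c i).ne h.ne, u, w, h, rfl, rfl⟩

theorem place_adj {i : Fin 3} {u w : (c i).Disk} (h : (diskGraph (c i)).Adj u w) :
    (diskGraph (node c)).Adj (place c i u) (place c i w) :=
  (diskGraph_node_adj c).mpr (Or.inr ⟨i, u, w, h, rfl, rfl⟩)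

theorem inl_adj : (t : SierpinskiTree) → {i j : Fin 3} → i ≠ j →
    t.diskGraph.Adj (Sum.inl i) (Sum.inl j)
  | leaf, _, _, h => fun h' => h (Sum.inl.inj h')
  | node c, i, j, h => (diskGraph_node_adj c).mpr (Or.inl ⟨i, j, h, rfl, rfl⟩)

/-! ### The faces of a subdivided triangle -/

variable {c}

/-- The oriented faces of a subdivided triangle, from those of the three corner triangles, whose
orientation is reversed. -/
def NodeFace (F : ∀ i, (c i).Disk → (c i).Disk → (c i).Disk → Prop) (x y z : (node c).Disk) : Prop :=
  (∃ u v w, MedialFace u v w ∧ x = medial c u ∧ y = medial c v ∧ z = medial c w) ∨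
    ∃ i u v w, F i u w v ∧ x = place c i u ∧ y = place c i v ∧ z = place c i w

variable {F : ∀ i, (c i).Disk → (c i).Disk → (c i).Disk → Prop}

theorem NodeFace.link_child {i : Fin 3} {u a b : (c i).Disk} (h : Relation.EqvGen (F i u) a b) :
    Relation.EqvGen (NodeFace F (place c i u)) (place c i a) (place c i b) := by
  induction h with
  | rel a b h => exact .symm _ _ (.rel _ _ (Or.inr ⟨i, u, b, a, h, rfl, rfl, rfl⟩))
  | refl a => exact .refl _
  | symm a b _ ih => exact .symm _ _ ih
  | trans a b d _ _ ih1 ih2 => exact .trans _ _ _ ih1 ih2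

theorem NodeFace.link_medial {u v w : Fin 3 ⊕ Fin 3} (h : MedialFace u v w) :
    Relation.EqvGen (NodeFace F (medial c u)) (medial c v) (medial c w) :=
  .rel _ _ (Or.inl ⟨u, v, w, h, rfl, rfl, rfl⟩)

/-- In the link of a corner `i` of the outer or inserted triangle, all vertices are connected to
the corner `i + 1` of the inserted triangle. -/
theorem NodeFace.link_hub (hF : ∀ i, IsOrientedDisk (diskGraph (c i)) Sum.inl (F i))
    {u : Fin 3 ⊕ Fin 3} {a : (node c).Disk} (ha : (diskGraph (node c)).Adj (medial c u) a) :
    Relation.EqvGen (NodeFace F (medial c u)) a (medial c (.inr (u.elim id id + 1))) := by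
  -- Seen from one corner of a corner triangle, the other two are connected through the link inside
  -- that triangle.
  have side : ∀ i j k l : Fin 3, j ≠ k → j ≠ l →
      Relation.EqvGen (NodeFace F (medial c (medialCorner i j)))
        (medial c (medialCorner i k)) (medial c (medialCorner i l)) := by
    intro i j k l hk hl
    rw [← place_inl, ← place_inl, ← place_inl]
    exact NodeFace.link_child ((hF i).link (inl_adj _ hk) (inl_adj _ hl))
  rcases (diskGraph_node_adj c).mp ha with ⟨i, j, hij, hi, rfl⟩ | ⟨i, x, w, hxw, hx, rfl⟩
  · obtain rfl : u = .inl i := medial_injective c hi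
    rcases Fin.three_eq_add_of_ne hij with rfl | rfl
    · have h1 : MedialFace (.inl i) (.inl (i + 1)) (.inr (i + 2)) := by
        clear ha hi hij
        revert i
        decide
      refine .trans _ _ _ (NodeFace.link_medial h1) ?_
      have h2 : ∀ i : Fin 3, medialCorner i i = .inl i ∧ medialCorner i (i + 1) = .inr (i + 1) ∧
          medialCorner i (i + 2) = .inr (i + 2) ∧ i ≠ i + 1 ∧ i ≠ i + 2 := by decide
      obtain ⟨e1, e2, e3, e4, e5⟩ := h2 i
      have := side i i (i + 2) (i + 1) e5 e4
      rwa [e1, e2, e3] at this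
    · have h1 : MedialFace (.inl (j + 1)) (.inr (j + 1 + 1)) (.inl j) := by
        clear ha hi hij
        revert j
        decide
      exact .symm _ _ (NodeFace.link_medial h1)
  · obtain ⟨j, rfl, rfl⟩ := exists_of_medial_eq_place c hx.symm
    -- The link inside the corner triangle leads to its `k`-th corner, chosen so that it is the hub
    -- itself or spans an unsubdivided face with the hub.
    have key : ∀ i j : Fin 3, ∃ k, j ≠ k ∧
        (medialCorner i k = .inr ((medialCorner i j).elim id id + 1) ∨
          MedialFace (medialCorner i j) (.inr ((medialCorner i j).elim id id + 1))
            (medialCorner i k)) := by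
      decide
    obtain ⟨k, hk, h⟩ := key i j
    have h1 := NodeFace.link_child ((hF i).link hxw (inl_adj _ hk))
    rw [place_inl, place_inl] at h1
    refine .trans _ _ _ h1 ?_
    rcases h with h | h
    · rw [h]
      exact .refl _
    · exact .symm _ _ (NodeFace.link_medial h)

/-- The reversed corner disks cover all their darts except those from corner `j` to corner `j + 1`,
and these are exactly the darts that the unsubdivided faces supply on their sides. Only the reversed
outer boundary stays uncovered. -/
theorem isOrientedDisk_nodeFace (hF : ∀ i, IsOrientedDisk (diskGraph (c i)) Sum.inl (F i)) :
    IsOrientedDisk (diskGraph (node c)) Sum.inl (NodeFace F) where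
  rotate := by
    rintro a b d (⟨u, v, w, h, rfl, rfl, rfl⟩ | ⟨i, u, v, w, h, rfl, rfl, rfl⟩)
    · exact Or.inl ⟨v, w, u, h.rotate, rfl, rfl, rfl⟩
    · exact Or.inr ⟨i, v, w, u, (hF i).rotate ((hF i).rotate h), rfl, rfl, rfl⟩
  adj := by
    rintro a b d (⟨u, v, w, h, rfl, rfl, rfl⟩ | ⟨i, u, v, w, h, rfl, rfl, rfl⟩)
    · rcases h.edge with ⟨i, rfl, rfl⟩ | ⟨i, j, rfl, rfl⟩
      · exact inl_adj (node c) (Fin.ne_add_one i)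
      · rw [← place_inl, ← place_inl]
        exact place_adj c (inl_adj _ (Fin.ne_add_one j))
    · exact place_adj c ((hF i).adj ((hF i).rotate ((hF i).rotate h))).symm
  unique := by
    have mixed : ∀ {p q r : Fin 3 ⊕ Fin 3} {i : Fin 3} {u v w : (c i).Disk}, MedialFace p q r →
        F i u w v → medial c p = place c i u → medial c q = place c i v → False := by
      intro p q r i u v w h h' hp hq
      obtain ⟨j, rfl, rfl⟩ := exists_of_medial_eq_place c hp
      obtain ⟨k, rfl, rfl⟩ := exists_of_medial_eq_place c hq
      obtain rfl := h.corner_eq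
      exact (hF i).boundary j w ((hF i).rotate ((hF i).rotate h'))
    rintro a b d d' (⟨u, v, w, h, rfl, rfl, rfl⟩ | ⟨i, u, v, w, h, rfl, rfl, rfl⟩)
      (⟨u', v', w', h', hu, hv, rfl⟩ | ⟨i', u', v', w', h', hu, hv, rfl⟩)
    · obtain rfl := medial_injective c hu
      obtain rfl := medial_injective c hv
      rw [h.unique h']
    · exact (mixed h h' hu hv).elim
    · exact (mixed h' h hu.symm hv.symm).elim
    · by_cases hi : i = i'
      · subst hi
        obtain rfl := place_injective c i hu
        obtain rfl := place_injective c i hv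
        rw [(hF i).unique ((hF i).rotate ((hF i).rotate h)) ((hF i).rotate ((hF i).rotate h'))]
      · have := eq_of_place_eq_place c hi hu hv
        exact absurd this ((hF i).adj ((hF i).rotate ((hF i).rotate h))).ne'
  exists_third := by
    intro a b hab
    rcases (diskGraph_node_adj c).mp hab with ⟨i, j, hij, rfl, rfl⟩ | ⟨i, u, w, h, rfl, rfl⟩
    · rcases Fin.three_eq_add_of_ne hij with rfl | rfl
      · obtain ⟨z, hz⟩ := MedialFace.exists_outer i
        exact Or.inl ⟨_, Or.inl ⟨_, _, z, hz, rfl, rfl, rfl⟩⟩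
      · exact Or.inr ⟨j, rfl, rfl⟩
    · left
      -- The reversed dart is looked up because the orientation of the corner disk is reversed. If
      -- it is an exceptional boundary dart, an unsubdivided face takes over.
      rcases (hF i).exists_third h.symm with ⟨z, hz⟩ | ⟨j, rfl, rfl⟩
      · exact ⟨_, Or.inr ⟨i, u, w, z, (hF i).rotate hz, rfl, rfl, rfl⟩⟩
      · obtain ⟨z, hz⟩ := MedialFace.exists_corner i j
        rw [place_inl, place_inl]
        exact ⟨_, Or.inl ⟨_, _, z, hz, rfl, rfl, rfl⟩⟩
  boundary := by
    rintro i x (⟨u, v, w, h, hu, hv, rfl⟩ | ⟨j, u, v, w, h, hu, hv, rfl⟩)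
    · obtain rfl : .inl (i + 1) = u := medial_injective c hu
      obtain rfl : .inl i = v := medial_injective c hv
      exact MedialFace.not_outer _ _ h
    · have h1 := (place_eq_inl c hu.symm).1
      have h2 := (place_eq_inl c hv.symm).1
      exact Fin.ne_add_one i (h2.trans h1.symm)
  link := by
    intro v a b ha hb
    rcases eq_medial_or_eq_place c v with ⟨u, rfl⟩ | ⟨i, x, rfl⟩
    · exact .trans _ _ _ (NodeFace.link_hub hF ha) (.symm _ _ (NodeFace.link_hub hF hb))
    · have key : ∀ {a}, (diskGraph (node c)).Adj (place c i (Sum.inr x)) a →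
          ∃ w, (diskGraph (c i)).Adj (Sum.inr x) w ∧ a = place c i w := by
        intro a ha
        rcases (diskGraph_node_adj c).mp ha with ⟨j, k, -, hj, -⟩ | ⟨j, u, w, h, hu, rfl⟩
        · exact absurd hj.symm (medial_ne_place_inr c (Sum.inl j) i x)
        · obtain rfl := eq_of_place_inr_eq c hu.symm
          obtain rfl := place_injective c _ hu
          exact ⟨w, h, rfl⟩
      obtain ⟨a, ha', rfl⟩ := key ha
      obtain ⟨b, hb', rfl⟩ := key hb
      exact NodeFace.link_child ((hF i).link ha' hb')

theorem exists_isOrientedDisk (t : SierpinskiTree) :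
    ∃ F, IsOrientedDisk t.diskGraph Sum.inl F := by
  induction t with
  | leaf => exact ⟨LeafFace, isOrientedDisk_leafFace⟩
  | node c ih =>
    choose F hF using ih
    exact ⟨NodeFace F, isOrientedDisk_nodeFace hF⟩

/-! ### The number of edges -/

theorem card_interior_node (c : Fin 3 → SierpinskiTree) :
    Nat.card (node c).Interior = 3 + ∑ i, Nat.card (c i).Interior := by
  change Nat.card (Fin 3 ⊕ (Σ i, (c i).Interior)) = _
  rw [Nat.card_sum, Nat.card_sigma, Nat.card_fin]

theorem card_top_fin_three : Nat.card (⊤ : SimpleGraph (Fin 3)).edgeSet = 3 := by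
  rw [Nat.card_eq_fintype_card]
  decide

theorem card_top_leaf : Nat.card (⊤ : SimpleGraph (Fin 3 ⊕ Unit)).edgeSet = 6 := by
  rw [Nat.card_eq_fintype_card]
  decide

/-- The outer triangle inside the subdivided triangle. -/
def outerHom (t : SierpinskiTree) : (⊤ : SimpleGraph (Fin 3)) →g t.diskGraph where
  toFun := Sum.inl
  map_rel' h := inl_adj t h

/-- A corner triangle inside the subdivided triangle. -/
def placeHom (c : Fin 3 → SierpinskiTree) (i : Fin 3) : (c i).diskGraph →g (node c).diskGraph where
  toFun := place c i
  map_rel' h := place_adj c h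

/-- The edges are the disjoint union of the outer triangle and the edges of the three corner
triangles, and `3 + ∑ (3 + 3 mᵢ) = 3 + 3 (3 + ∑ mᵢ)`. -/
theorem card_edgeSet_diskGraph (t : SierpinskiTree) :
    Nat.card t.diskGraph.edgeSet = 3 + 3 * Nat.card t.Interior := by
  induction t with
  | leaf =>
    refine Eq.trans card_top_leaf ?_
    change 6 = 3 + 3 * Nat.card Unit
    simp
  | node c ih =>
    have hbij : Function.Bijective (Sum.elim (outerHom (node c)).mapEdgeSet
        fun p : Σ i, (c i).diskGraph.edgeSet => (placeHom c p.1).mapEdgeSet p.2) := by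
      constructor
      · have mixed : ∀ (e : (⊤ : SimpleGraph (Fin 3)).edgeSet) (i : Fin 3)
            (e' : (c i).diskGraph.edgeSet),
            (outerHom (node c)).mapEdgeSet e ≠ (placeHom c i).mapEdgeSet e' := by
          rintro ⟨e, he⟩ i ⟨e', he'⟩ h
          have h' : Sym2.map (Sum.inl : Fin 3 → (node c).Disk) e = Sym2.map (place c i) e' :=
            congrArg Subtype.val h
          induction e with | _ a b
          induction e' with | _ x y
          have hab : a ≠ b := he
          rw [Sym2.map_mk, Sym2.map_mk, Sym2.eq_iff] at h'
          rcases h' with ⟨h1, h2⟩ | ⟨h1, h2⟩ <;>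
            exact hab ((place_eq_inl c h1.symm).1.trans (place_eq_inl c h2.symm).1.symm)
        rintro (e | ⟨i, e⟩) (e' | ⟨i', e'⟩) h
        · exact congrArg _ (SimpleGraph.Hom.mapEdgeSet.injective _ Sum.inl_injective h)
        · exact (mixed _ _ _ h).elim
        · exact (mixed _ _ _ h.symm).elim
        · by_cases hi : i = i'
          · subst hi
            obtain rfl := SimpleGraph.Hom.mapEdgeSet.injective _ (place_injective c i) h
            rfl
          · exfalso
            obtain ⟨e, he⟩ := e
            obtain ⟨e', he'⟩ := e'
            have h' : Sym2.map (place c i) e = Sym2.map (place c i') e' := congrArg Subtype.val h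
            induction e with | _ a b
            induction e' with | _ x y
            have hab : (c i).diskGraph.Adj a b := he
            rw [Sym2.map_mk, Sym2.map_mk, Sym2.eq_iff] at h'
            rcases h' with ⟨h1, h2⟩ | ⟨h1, h2⟩ <;>
              exact hab.ne (eq_of_place_eq_place c hi h1 h2)
      · rintro ⟨e, he⟩
        induction e with | _ a b
        rcases (diskGraph_node_adj c).mp he with ⟨i, j, hij, rfl, rfl⟩ | ⟨i, u, w, h, rfl, rfl⟩
        · exact ⟨Sum.inl ⟨s(i, j), hij⟩, rfl⟩
        · exact ⟨Sum.inr ⟨i, ⟨s(u, w), h⟩⟩, rfl⟩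
    have hfin : ∀ i, Finite (c i).diskGraph.edgeSet := fun i => inferInstance
    rw [← Nat.card_eq_of_bijective _ hbij, Nat.card_sum, Nat.card_sigma, card_top_fin_three,
      card_interior_node, Fin.sum_univ_three, Fin.sum_univ_three, ih, ih, ih]
    ring

end SierpinskiTree

/-! ### Paths inside a set of vertices -/

/-- The graph `G` without the edges that leave the set `S`. -/
def SimpleGraph.within {V : Type*} (G : SimpleGraph V) (S : Set V) : SimpleGraph V where
  Adj a b := a ∈ S ∧ b ∈ S ∧ G.Adj a b
  symm := ⟨fun _ _ h => ⟨h.2.1, h.1, h.2.2.symm⟩⟩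
  loopless := ⟨fun _ h => h.2.2.ne rfl⟩

theorem SimpleGraph.within_reachable_map {V W : Type*} {G : SimpleGraph V} {H : SimpleGraph W}
    {S : Set V} {T : Set W} {x y : V} (h : (G.within S).Reachable x y) (f : V → W)
    (hf : ∀ {a b}, G.Adj a b → H.Adj (f a) (f b)) (hS : ∀ a ∈ S, f a ∈ T) :
    (H.within T).Reachable (f x) (f y) :=
  h.map (⟨f, fun h => ⟨hS _ h.1, hS _ h.2.1, hf h.2.2⟩⟩ : G.within S →g H.within T)

theorem SimpleGraph.within_mono {V : Type*} {G : SimpleGraph V} {S T : Set V} {x y : V}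
    (h : (G.within S).Reachable x y) (hS : S ⊆ T) : (G.within T).Reachable x y :=
  SimpleGraph.within_reachable_map h id id hS

theorem SimpleGraph.induce_reachable_of_within {V : Type*} {G : SimpleGraph V} {S : Set V}
    {x y : V} (h : (G.within S).Reachable x y) (hx : x ∈ S) (hy : y ∈ S) :
    (G.induce S).Reachable ⟨x, hx⟩ ⟨y, hy⟩ := by
  obtain ⟨p⟩ := h
  induction p with
  | nil => exact .refl _
  | cons hadj _ ih =>
    refine .trans (SimpleGraph.Adj.reachable ?_) (ih hadj.2.1 hy)
    exact hadj.2.2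

/-- If a set cuts the graph into two connected parts, then its removal leaves two components. -/
theorem SimpleGraph.Cuts.card_connectedComponent {V : Type*} {G : SimpleGraph V} {D : Finset V}
    {A : Set V} (h : G.Cuts D A) (hA : ∀ a ∈ A, ∀ b ∈ A, (G.within A).Reachable a b)
    {o : V} (ho : o ∉ A ∧ o ∉ D)
    (hB : ∀ b, b ∉ A → b ∉ D → (G.within {y | y ∉ A ∧ y ∉ D}).Reachable b o) :
    Nat.card (G.induce (D : Set V)ᶜ).ConnectedComponent = 2 := by
  obtain ⟨a, ha⟩ := h.nonempty
  have hmem : ∀ {x}, x ∉ D → x ∈ (D : Set V)ᶜ := fun hx h => hx (Finset.mem_coe.mp h)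
  rw [Nat.card_eq_two_iff]
  refine ⟨SimpleGraph.connectedComponentMk _ ⟨a, hmem (h.disjoint a ha)⟩,
    SimpleGraph.connectedComponentMk _ ⟨o, hmem ho.2⟩, fun he => ?_, ?_⟩
  · exact ho.1 (h.reachable_mem (SimpleGraph.ConnectedComponent.exact he) ha)
  · refine Set.eq_univ_of_forall fun q => ?_
    induction q using SimpleGraph.ConnectedComponent.ind with | _ x
    obtain ⟨x, hx⟩ := x
    have hxD : x ∉ D := fun hxD => hx (Finset.mem_coe.mpr hxD)
    by_cases hxA : x ∈ A
    · left
      refine SimpleGraph.ConnectedComponent.sound (SimpleGraph.induce_reachable_of_within ?_ _ _)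
      exact SimpleGraph.within_mono (hA x hxA a ha) fun y hy => hmem (h.disjoint y hy)
    · right
      refine SimpleGraph.ConnectedComponent.sound (SimpleGraph.induce_reachable_of_within ?_ _ _)
      exact SimpleGraph.within_mono (hB x hxA hxD) fun y hy => hmem hy.2

namespace SierpinskiTree

/-! ### The interior of a subdivided triangle is connected -/

/-- The vertices in the interior of the subdivided triangle. -/
def interiorSet (t : SierpinskiTree) : Set t.Disk := Set.range Sum.inr

theorem exists_interior_adj : (t : SierpinskiTree) → (k : Fin 3) →
    ∃ x : t.Interior, t.diskGraph.Adj (Sum.inl k) (Sum.inr x)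
  | leaf, _ => ⟨(), fun h => by cases h⟩
  | node c, k => by
    refine ⟨(Sum.inl (k + 1) : Fin 3 ⊕ Σ i, (c i).Interior), ?_⟩
    have h := place_adj c (inl_adj (c k) (Fin.ne_add_one k))
    rw [place_inl, place_inl] at h
    have key : ∀ k : Fin 3, medialCorner k k = .inl k ∧ medialCorner k (k + 1) = .inr (k + 1) := by
      decide
    rwa [(key k).1, (key k).2] at h

/-- Every interior vertex is connected with each corner by a path that has no other corner. -/
theorem reachable_corner_of_interior (t : SierpinskiTree)
    (h : ∀ x y : t.Interior, (t.diskGraph.within t.interiorSet).Reachable (Sum.inr x) (Sum.inr y))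
    (x : t.Interior) (k : Fin 3) :
    (t.diskGraph.within (insert (Sum.inl k) t.interiorSet)).Reachable (Sum.inr x) (Sum.inl k) := by
  obtain ⟨y, hy⟩ := t.exists_interior_adj k
  refine .trans (SimpleGraph.within_mono (h x y) (Set.subset_insert _ _))
    (SimpleGraph.Adj.reachable ⟨?_, Set.mem_insert _ _, hy.symm⟩)
  exact Set.mem_insert_of_mem _ ⟨y, rfl⟩

theorem medial_inr_adj (c : Fin 3 → SierpinskiTree) {i j : Fin 3} (h : i ≠ j) :
    (node c).diskGraph.Adj (medial c (.inr i)) (medial c (.inr j)) := by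
  have key : ∀ i j : Fin 3, i ≠ j → ∃ k, medialCorner k i = .inr i ∧ medialCorner k j = .inr j := by
    decide
  obtain ⟨k, h1, h2⟩ := key i j h
  have h3 := place_adj c (inl_adj (c k) h)
  rwa [place_inl, place_inl, h1, h2] at h3

theorem medial_inl_inr_adj (c : Fin 3 → SierpinskiTree) {i j : Fin 3} (h : i ≠ j) :
    (node c).diskGraph.Adj (medial c (.inl i)) (medial c (.inr j)) := by
  have h3 := place_adj c (inl_adj (c i) h)
  rwa [place_inl, place_inl, medialCorner, medialCorner, if_pos rfl, if_neg h.symm] at h3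

/-- The inserted triangle is a connected core. The interior of the `i`-th corner triangle reaches it
through corner `i + 1`, which is an inserted vertex. -/
theorem interior_reachable (t : SierpinskiTree) (x y : t.Interior) :
    (t.diskGraph.within t.interiorSet).Reachable (Sum.inr x) (Sum.inr y) := by
  induction t with
  | leaf =>
    have : x = y := Subsingleton.elim (α := Unit) x y
    rw [this]
  | node c ih =>
    have hm : ∀ j, medial c (.inr j) ∈ (node c).interiorSet := fun j => ⟨_, rfl⟩
    have hmm : ∀ i j, ((node c).diskGraph.within (node c).interiorSet).Reachable
        (medial c (.inr i)) (medial c (.inr j)) := by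
      intro i j
      by_cases hij : i = j
      · rw [hij]
      · exact SimpleGraph.Adj.reachable ⟨hm i, hm j, medial_inr_adj c hij⟩
    have key : ∀ x : (node c).Interior, ((node c).diskGraph.within (node c).interiorSet).Reachable
        (Sum.inr x) (medial c (.inr 0)) := by
      rintro (j | ⟨i, x⟩)
      · exact hmm j 0
      · refine .trans ?_ (hmm (i + 1) 0)
        have h := reachable_corner_of_interior (c i) (ih i) x (i + 1)
        have h' := SimpleGraph.within_reachable_map (H := (node c).diskGraph)
          (T := (node c).interiorSet) h (place c i) (place_adj c) ?_
        · rwa [place_inl, medialCorner, if_neg (Fin.ne_add_one i).symm] at h'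
        · rintro a (rfl | ⟨a, rfl⟩)
          · rw [place_inl, medialCorner, if_neg (Fin.ne_add_one i).symm]
            exact hm _
          · exact ⟨_, rfl⟩
    exact (key x).trans (key y).symm

/-! ### The separating triangles -/

/-- The triangle `D` of a subdivided triangle has the vertices of `A` in its interior, and its
exterior is connected with the outside of the subdivided triangle. -/
structure IsRegion (t : SierpinskiTree) (D : Finset t.Disk) (A : Set t.Disk) : Prop where
  isNClique : t.diskGraph.IsNClique 3 D
  interior : A ⊆ t.interiorSet
  nonempty : A.Nonempty
  disjoint : ∀ a ∈ A, a ∉ D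
  closed : ∀ a ∈ A, ∀ x, t.diskGraph.Adj a x → x ∈ A ∨ x ∈ D
  inner : ∀ a ∈ A, ∀ b ∈ A, (t.diskGraph.within A).Reachable a b
  outer : ∀ x, x ∉ A → x ∉ D → ∃ k, Sum.inl k ∉ D ∧
    (t.diskGraph.within {y | y ∉ A ∧ y ∉ D}).Reachable x (Sum.inl k)

/-- The outer triangle, as a set of vertices of the subdivided triangle. -/
def outerTriangle (t : SierpinskiTree) : Finset t.Disk := Finset.univ.map ⟨Sum.inl, Sum.inl_injective⟩

theorem mem_outerTriangle {t : SierpinskiTree} {x : t.Disk} :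
    x ∈ t.outerTriangle ↔ ∃ i, Sum.inl i = x := by
  simp [outerTriangle]

theorem isRegion_outerTriangle (t : SierpinskiTree) : t.IsRegion t.outerTriangle t.interiorSet where
  isNClique := by
    refine ⟨?_, by simp [outerTriangle]⟩
    intro x hx y hy hxy
    obtain ⟨i, rfl⟩ := mem_outerTriangle.mp (Finset.mem_coe.mp hx)
    obtain ⟨j, rfl⟩ := mem_outerTriangle.mp (Finset.mem_coe.mp hy)
    exact inl_adj t fun h => hxy (congrArg _ h)
  interior := subset_rfl
  nonempty := by
    obtain ⟨x, -⟩ := t.exists_interior_adj 0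
    exact ⟨_, x, rfl⟩
  disjoint := by
    rintro _ ⟨x, rfl⟩ h
    obtain ⟨i, hi⟩ := mem_outerTriangle.mp h
    cases hi
  closed := by
    rintro a - (x | x) -
    · exact Or.inr (mem_outerTriangle.mpr ⟨x, rfl⟩)
    · exact Or.inl ⟨x, rfl⟩
  inner := by
    rintro _ ⟨a, rfl⟩ _ ⟨b, rfl⟩
    exact t.interior_reachable a b
  outer := by
    rintro (x | x) h1 h2
    · exact absurd (mem_outerTriangle.mpr ⟨x, rfl⟩) h2
    · exact absurd ⟨x, rfl⟩ h1

variable {c : Fin 3 → SierpinskiTree}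

/-- The embedding of a corner triangle into the subdivided triangle. -/
def placeEmb (c : Fin 3 → SierpinskiTree) (i : Fin 3) : (c i).Disk ↪ (node c).Disk :=
  ⟨place c i, place_injective c i⟩

theorem inl_notMem_map_placeEmb {i k : Fin 3} (hk : k ≠ i) (D : Finset (c i).Disk) :
    Sum.inl k ∉ D.map (placeEmb c i) := by
  intro h
  obtain ⟨x, -, hx⟩ := Finset.mem_map.mp h
  exact hk (place_eq_inl c hx).1

theorem place_mem_map {i : Fin 3} {D : Finset (c i).Disk} {x : (c i).Disk} :
    place c i x ∈ D.map (placeEmb c i) ↔ x ∈ D :=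
  Finset.mem_map' (placeEmb c i)

/-- Interior vertices of a corner triangle gain no neighbours in the larger graph, so the cut
persists. For the exterior, the outer corners other than `i` avoid the corner triangle altogether
and serve as exits. -/
theorem IsRegion.place {i : Fin 3} {D : Finset (c i).Disk} {A : Set (c i).Disk}
    (h : (c i).IsRegion D A) : (node c).IsRegion (D.map (placeEmb c i)) (place c i '' A) where
  isNClique := by
    refine ⟨?_, by rw [Finset.card_map, h.isNClique.card_eq]⟩
    rw [Finset.coe_map]
    rintro _ ⟨x, hx, rfl⟩ _ ⟨y, hy, rfl⟩ hxy
    exact place_adj c (h.isNClique.isClique hx hy fun e => hxy (congrArg _ e))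
  interior := by
    rintro _ ⟨a, ha, rfl⟩
    obtain ⟨x, rfl⟩ := h.interior ha
    exact ⟨_, rfl⟩
  nonempty := h.nonempty.image _
  disjoint := by
    rintro _ ⟨a, ha, rfl⟩ hD
    exact h.disjoint a ha (place_mem_map.mp hD)
  closed := by
    rintro _ ⟨a, ha, rfl⟩ x hx
    obtain ⟨a, rfl⟩ := h.interior ha
    rcases (diskGraph_node_adj c).mp hx with ⟨j, k, -, hj, -⟩ | ⟨j, u, w, huw, hu, rfl⟩
    · exact absurd hj.symm (medial_ne_place_inr c (Sum.inl j) i a)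
    · obtain rfl := eq_of_place_inr_eq c hu.symm
      obtain rfl := place_injective c _ hu
      exact (h.closed _ ha w huw).imp (fun hw => ⟨w, hw, rfl⟩) place_mem_map.mpr
  inner := by
    rintro _ ⟨a, ha, rfl⟩ _ ⟨b, hb, rfl⟩
    exact SimpleGraph.within_reachable_map (h.inner a ha b hb) _ (place_adj c)
      fun x hx => ⟨x, hx, rfl⟩
  outer := by
    set S : Set (node c).Disk := {y | y ∉ SierpinskiTree.place c i '' A ∧ y ∉ D.map (placeEmb c i)}
    have hS : ∀ y, (∀ x, SierpinskiTree.place c i x ≠ y) → y ∈ S := by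
      intro y hy
      refine ⟨?_, fun h => ?_⟩
      · rintro ⟨x, -, hx⟩
        exact hy x hx
      · obtain ⟨x, -, hx⟩ := Finset.mem_map.mp h
        exact hy x hx
    have hinl : ∀ k, k ≠ i → Sum.inl k ∈ S := fun k hk =>
      hS _ fun x hx => hk (place_eq_inl c hx).1
    have hSi : ∀ a ∈ {y | y ∉ A ∧ y ∉ D}, SierpinskiTree.place c i a ∈ S := by
      rintro a ⟨h1, h2⟩
      refine ⟨?_, fun hD => h2 (place_mem_map.mp hD)⟩
      rintro ⟨b, hb, hab⟩
      exact h1 (place_injective c i hab ▸ hb)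
    have hcorner : ∀ j, medial c (.inr j) ∈ S → ∃ k, Sum.inl k ∉ D.map (placeEmb c i) ∧
        ((node c).diskGraph.within S).Reachable (medial c (.inr j)) (Sum.inl k) := by
      intro j hj
      -- An inserted vertex `j` is adjacent to all outer corners but the `j`-th. Excluding `i` as
      -- well keeps the exit outside the `i`-th corner triangle.
      obtain ⟨k, hki, hkj⟩ : ∃ k, k ≠ i ∧ k ≠ j := by
        clear * -
        revert i j
        decide
      exact ⟨k, inl_notMem_map_placeEmb hki D, SimpleGraph.Adj.reachable
        ⟨hj, hinl k hki, (medial_inl_inr_adj c hkj).symm⟩⟩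
    have hin : ∀ x, SierpinskiTree.place c i x ∈ S → ∃ k, Sum.inl k ∉ D.map (placeEmb c i) ∧
        ((node c).diskGraph.within S).Reachable (SierpinskiTree.place c i x) (Sum.inl k) := by
      intro x hx
      obtain ⟨k, hkD, hk⟩ := h.outer x (fun hA => hx.1 ⟨x, hA, rfl⟩)
        (fun hD => hx.2 (place_mem_map.mpr hD))
      have hk' := SimpleGraph.within_reachable_map (H := (node c).diskGraph) (T := S) hk _
        (place_adj c) hSi
      have hkS : SierpinskiTree.place c i (Sum.inl k) ∈ S := by
        refine hSi _ ⟨fun hA => ?_, hkD⟩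
        obtain ⟨y, hy⟩ := h.interior hA
        cases hy
      rw [place_inl] at hk' hkS
      by_cases hki : k = i
      · rw [medialCorner, if_pos hki] at hk' hkS
        exact ⟨i, hkS.2, hk'⟩
      · rw [medialCorner, if_neg hki] at hk' hkS
        obtain ⟨l, hl, hl'⟩ := hcorner k hkS
        exact ⟨l, hl, hk'.trans hl'⟩
    intro x hxA hxD
    rcases eq_medial_or_eq_place c x with ⟨j | j, rfl⟩ | ⟨j, x, rfl⟩
    · exact ⟨j, hxD, .refl _⟩
    · exact hcorner j ⟨hxA, hxD⟩
    · by_cases hij : j = i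
      · subst hij
        exact hin _ ⟨hxA, hxD⟩
      · refine ⟨j, inl_notMem_map_placeEmb hij D, ?_⟩
        -- This path uses only interior vertices and the one corner `j`, so it avoids the inserted
        -- vertices, which may belong to `D`.
        have h1 := reachable_corner_of_interior (c j) (interior_reachable (c j)) x j
        have h2 := SimpleGraph.within_reachable_map (H := (node c).diskGraph) (T := S) h1
          (SierpinskiTree.place c j) (place_adj c) ?_
        · rwa [place_inl, medialCorner, if_pos rfl] at h2
        · rintro a (rfl | ⟨a, rfl⟩)
          · rw [place_inl, medialCorner, if_pos rfl]
            exact hinl j hij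
          · exact hS _ fun y hy => hij (eq_of_place_inr_eq c hy.symm)

/-- A subdivided triangle with `m` interior vertices has a family of `(3 m + 2) / 5` separating
triangles any two of which share at most one vertex. -/
theorem exists_regions (t : SierpinskiTree) :
    ∃ (ι : Type) (_ : Fintype ι) (D : ι → Finset t.Disk),
      5 * Fintype.card ι = 3 * Nat.card t.Interior + 2 ∧ (∀ p, ∃ A, t.IsRegion (D p) A) ∧
      ∀ p q, p ≠ q → ∀ a ∈ D p, ∀ b ∈ D p, a ∈ D q → b ∈ D q → a = b := by
  induction t with
  | leaf =>
    refine ⟨Unit, inferInstance, fun _ => outerTriangle _, ?_,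
      fun _ => ⟨_, isRegion_outerTriangle _⟩, fun p q h => absurd rfl h⟩
    change 5 * Fintype.card Unit = 3 * Nat.card Unit + 2
    simp
  | node c ih =>
    choose ι hι D hcard hreg hdisj using ih
    have mixed : ∀ i (p : ι i) (a b : (node c).Disk), a ∈ outerTriangle (node c) →
        b ∈ outerTriangle (node c) → a ∈ (D i p).map (placeEmb c i) →
        b ∈ (D i p).map (placeEmb c i) → a = b := by
      intro i p a b ha hb ha' hb'
      obtain ⟨j, rfl⟩ := mem_outerTriangle.mp ha
      obtain ⟨k, rfl⟩ := mem_outerTriangle.mp hb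
      obtain ⟨x, -, hx⟩ := Finset.mem_map.mp ha'
      obtain ⟨y, -, hy⟩ := Finset.mem_map.mp hb'
      rw [(place_eq_inl c hx).1, (place_eq_inl c hy).1]
    refine ⟨Option (Σ i, ι i), inferInstance, fun p => p.elim (outerTriangle _)
      fun p => (D p.1 p.2).map (placeEmb c p.1), ?_, ?_, ?_⟩
    -- The outer triangle adds one to the children's families: `5 + ∑ (3 mᵢ + 2) = 3 (3 + ∑ mᵢ) +
    -- 2`.
    · rw [Fintype.card_option, Fintype.card_sigma, card_interior_node, Fin.sum_univ_three,
        Fin.sum_univ_three]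
      have h0 := hcard 0
      have h1 := hcard 1
      have h2 := hcard 2
      omega
    · rintro (_ | ⟨i, p⟩)
      · exact ⟨_, isRegion_outerTriangle _⟩
      · obtain ⟨A, hA⟩ := hreg i p
        exact ⟨_, hA.place⟩
    · rintro (_ | ⟨i, p⟩) (_ | ⟨j, q⟩) hpq a ha b hb ha' hb'
      · exact absurd rfl hpq
      · exact mixed j q a b ha hb ha' hb'
      · exact mixed i p a b ha' hb' ha hb
      · obtain ⟨x, hx, rfl⟩ := Finset.mem_map.mp ha
        obtain ⟨y, hy, rfl⟩ := Finset.mem_map.mp hb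
        by_cases hij : i = j
        · subst hij
          have hpq' : p ≠ q := fun h => hpq (by rw [h])
          rw [hdisj i p q hpq' x hx y hy (place_mem_map.mp ha') (place_mem_map.mp hb')]
        · obtain ⟨x', -, hx'⟩ := Finset.mem_map.mp ha'
          obtain ⟨y', -, hy'⟩ := Finset.mem_map.mp hb'
          rw [eq_of_place_eq_place c hij hx'.symm hy'.symm]

end SierpinskiTree

namespace SierpinskiTree

/-! ### The Sierpiński-like graph -/

variable {t : SierpinskiTree}

theorem graph_adj_some {a b : t.Disk} : t.graph.Adj (some a) (some b) ↔ t.diskGraph.Adj a b := by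
  simp only [graph, SimpleGraph.sup_adj, SimpleGraph.map_adj', SimpleGraph.fromRel_adj]
  constructor
  · rintro (⟨-, u, v, h, hu, hv⟩ | ⟨-, ⟨h, -⟩ | ⟨h, -⟩⟩)
    · rwa [← Option.some_injective _ hu, ← Option.some_injective _ hv]
    · cases h
    · cases h
  · exact fun h => Or.inl ⟨(Option.some_injective _).ne h.ne, a, b, h, rfl, rfl⟩

theorem graph_adj_none {x : t.Vertex} :
    t.graph.Adj none x ↔ ∃ i : Fin 3, x = some (Sum.inl i) := by
  simp only [graph, SimpleGraph.sup_adj, SimpleGraph.map_adj', SimpleGraph.fromRel_adj]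
  constructor
  · rintro (⟨-, u, v, -, hu, -⟩ | ⟨-, ⟨-, h⟩ | ⟨-, i, h⟩⟩)
    · cases hu
    · exact h
    · cases h
  · rintro ⟨i, rfl⟩
    exact Or.inr ⟨fun h => (by cases h), Or.inl ⟨trivial, i, rfl⟩⟩

theorem natCard_vertex (t : SierpinskiTree) : Nat.card t.Vertex = Nat.card t.Interior + 4 := by
  change Nat.card (Option (Fin 3 ⊕ t.Interior)) = _
  rw [Finite.card_option, Nat.card_sum, Nat.card_fin]
  omega

theorem connected_graph (t : SierpinskiTree) : t.graph.Connected := by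
  have hc : ∀ i, t.graph.Reachable (some (Sum.inl i)) none := fun i =>
    (graph_adj_none.mpr ⟨i, rfl⟩).symm.reachable
  have key : ∀ x, t.graph.Reachable x none := by
    rintro (_ | x | x)
    · exact .refl _
    · exact hc x
    · have h := t.reachable_corner_of_interior t.interior_reachable x 0
      exact (h.map (⟨some, fun h => graph_adj_some.mpr h.2.2⟩ :
        t.diskGraph.within (insert (Sum.inl 0) t.interiorSet) →g t.graph)).trans (hc 0)
  exact { preconnected := fun x y => (key x).trans (key y).symm, nonempty := ⟨none⟩ }

theorem card_edgeSet_graph (t : SierpinskiTree) :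
    Nat.card t.graph.edgeSet = 6 + 3 * Nat.card t.Interior := by
  let f : t.diskGraph →g t.graph := ⟨some, fun h => graph_adj_some.mpr h⟩
  let g : Fin 3 → t.graph.edgeSet := fun i => ⟨s(none, some (Sum.inl i)),
    graph_adj_none.mpr ⟨i, rfl⟩⟩
  have hbij : Function.Bijective (Sum.elim f.mapEdgeSet g) := by
    constructor
    · have mixed : ∀ (e : t.diskGraph.edgeSet) (i : Fin 3), f.mapEdgeSet e ≠ g i := by
        rintro ⟨e, he⟩ i h
        have h' : Sym2.map (some : t.Disk → t.Vertex) e = s(none, some (Sum.inl i)) :=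
          congrArg Subtype.val h
        induction e with | _ a b
        rw [Sym2.map_mk, Sym2.eq_iff] at h'
        rcases h' with ⟨h, -⟩ | ⟨-, h⟩ <;> cases h
      rintro (e | i) (e' | j) h
      · exact congrArg _ (SimpleGraph.Hom.mapEdgeSet.injective f (Option.some_injective _) h)
      · exact (mixed _ _ h).elim
      · exact (mixed _ _ h.symm).elim
      · have h' : s(none, some (Sum.inl i)) = s((none : t.Vertex), some (Sum.inl j)) :=
          congrArg Subtype.val h
        rw [Sym2.eq_iff] at h'
        rcases h' with ⟨-, h⟩ | ⟨h, -⟩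
        · exact congrArg _ (Sum.inl.inj (Option.some.inj h))
        · cases h
    · rintro ⟨e, he⟩
      induction e with | _ a b
      rcases a with _ | a
      · obtain ⟨i, rfl⟩ := graph_adj_none.mp he
        exact ⟨Sum.inr i, rfl⟩
      · rcases b with _ | b
        · obtain ⟨i, hi⟩ := graph_adj_none.mp he.symm
          refine ⟨Sum.inr i, Subtype.ext ?_⟩
          obtain rfl := Option.some.inj hi
          exact Sym2.eq_swap
        · exact ⟨Sum.inl ⟨s(a, b), graph_adj_some.mp he⟩, rfl⟩
  rw [← Nat.card_eq_of_bijective _ hbij, Nat.card_sum, card_edgeSet_diskGraph, Nat.card_fin]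
  ring

/-- The oriented faces of the Sierpiński-like graph, from those of the subdivided triangle. -/
def SphereFace (F : t.Disk → t.Disk → t.Disk → Prop) (x y z : t.Vertex) : Prop :=
  (∃ a b c, F a b c ∧ x = some a ∧ y = some b ∧ z = some c) ∨
    ∃ i : Fin 3, (x = none ∧ y = some (.inl (i + 1)) ∧ z = some (.inl i)) ∨
      (x = some (.inl (i + 1)) ∧ y = some (.inl i) ∧ z = none) ∨
      (x = some (.inl i) ∧ y = none ∧ z = some (.inl (i + 1)))

/-- The three triangles at the exterior vertex contain exactly the reversed boundary darts that the
disk leaves uncovered, and so close it up to a sphere. -/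
theorem isOrientedTriangulation_sphereFace {F : t.Disk → t.Disk → t.Disk → Prop}
    (hF : IsOrientedDisk t.diskGraph Sum.inl F) :
    IsOrientedTriangulation t.graph (SphereFace F) where
  rotate := by
    rintro x y z (⟨a, b, c, h, rfl, rfl, rfl⟩ | ⟨i, ⟨rfl, rfl, rfl⟩ | ⟨rfl, rfl, rfl⟩ | ⟨rfl, rfl, rfl⟩⟩)
    · exact Or.inl ⟨b, c, a, hF.rotate h, rfl, rfl, rfl⟩
    · exact Or.inr ⟨i, Or.inr (Or.inl ⟨rfl, rfl, rfl⟩)⟩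
    · exact Or.inr ⟨i, Or.inr (Or.inr ⟨rfl, rfl, rfl⟩)⟩
    · exact Or.inr ⟨i, Or.inl ⟨rfl, rfl, rfl⟩⟩
  adj := by
    rintro x y z (⟨a, b, c, h, rfl, rfl, rfl⟩ | ⟨i, ⟨rfl, rfl, rfl⟩ | ⟨rfl, rfl, rfl⟩ | ⟨rfl, rfl, rfl⟩⟩)
    · exact graph_adj_some.mpr (hF.adj h)
    · exact graph_adj_none.mpr ⟨_, rfl⟩
    · exact graph_adj_some.mpr (inl_adj t (Fin.ne_add_one i).symm)
    · exact (graph_adj_none.mpr ⟨_, rfl⟩).symm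
  unique := by
    have hinj : ∀ {i j : Fin 3}, (some (.inl i) : t.Vertex) = some (.inl j) → i = j :=
      fun h => Sum.inl.inj (Option.some.inj h)
    have mixed : ∀ {a b c : t.Disk} {i : Fin 3}, F a b c →
        (some a : t.Vertex) = some (.inl (i + 1)) → (some b : t.Vertex) = some (.inl i) → False := by
      intro a b c i h ha hb
      rw [Option.some.inj ha, Option.some.inj hb] at h
      exact hF.boundary i c h
    have hne : ∀ i j : Fin 3, i + 1 = j → i = j + 1 → False := by decide
    rintro x y z z' (⟨a, b, c, h, rfl, rfl, rfl⟩ | ⟨i, ⟨rfl, rfl, rfl⟩ | ⟨rfl, rfl, rfl⟩ | ⟨rfl, rfl, rfl⟩⟩)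
      (⟨a', b', c', h', hx, hy, rfl⟩ | ⟨j, ⟨hx, hy, rfl⟩ | ⟨hx, hy, rfl⟩ | ⟨hx, hy, rfl⟩⟩)
    · rw [← Option.some.inj hx, ← Option.some.inj hy] at h'
      rw [hF.unique h h']
    · cases hx
    · exact (mixed h hx hy).elim
    · cases hy
    · cases hx
    · rw [add_right_cancel (hinj hy)]
    · cases hx
    · cases hx
    · exact (mixed h' hx.symm hy.symm).elim
    · cases hx
    · rfl
    · cases hy
    · cases hy
    · cases hx
    · cases hy
    · rw [hinj hx]
  exists_third := by
    have hadd : ∀ i : Fin 3, ∃ j, i = j + 1 := by decide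
    rintro (_ | a) y hxy
    · obtain ⟨i, rfl⟩ := graph_adj_none.mp hxy
      obtain ⟨j, rfl⟩ := hadd i
      exact ⟨_, Or.inr ⟨j, Or.inl ⟨rfl, rfl, rfl⟩⟩⟩
    · rcases y with _ | b
      · obtain ⟨i, hi⟩ := graph_adj_none.mp hxy.symm
        exact ⟨_, Or.inr ⟨i, Or.inr (Or.inr ⟨hi, rfl, rfl⟩)⟩⟩
      · rcases hF.exists_third (graph_adj_some.mp hxy) with ⟨c, hc⟩ | ⟨i, rfl, rfl⟩
        · exact ⟨_, Or.inl ⟨a, b, c, hc, rfl, rfl, rfl⟩⟩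
        · exact ⟨_, Or.inr ⟨i, Or.inr (Or.inl ⟨rfl, rfl, rfl⟩)⟩⟩
  link := by
    have hsome : ∀ {v a b}, Relation.EqvGen (F v) a b →
        Relation.EqvGen (SphereFace F (some v)) (some a) (some b) := by
      intro v a b h
      induction h with
      | rel a b h => exact .rel _ _ (Or.inl ⟨v, a, b, h, rfl, rfl, rfl⟩)
      | refl a => exact .refl _
      | symm a b _ ih => exact .symm _ _ ih
      | trans a b d _ _ ih1 ih2 => exact .trans _ _ _ ih1 ih2
    have hnone : ∀ i : Fin 3, Relation.EqvGen (SphereFace F none) (some (.inl (i + 1)))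
        (some (.inl i)) := fun i => .rel _ _ (Or.inr ⟨i, Or.inl ⟨rfl, rfl, rfl⟩⟩)
    have hnone' : ∀ i j : Fin 3, Relation.EqvGen (SphereFace F none) (some (.inl i))
        (some (.inl j)) := by
      intro i j
      by_cases hij : i = j
      · rw [hij]
        exact .refl _
      · rcases Fin.three_eq_add_of_ne hij with rfl | rfl
        · exact .symm _ _ (hnone i)
        · exact hnone j
    -- At a corner the only new neighbour is `none`. One exterior face ties it to the next corner,
    -- which reduces the link to the one in the disk.
    have key : ∀ {v : t.Disk} {a}, t.graph.Adj (some v) a → ∃ b, t.diskGraph.Adj v b ∧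
        Relation.EqvGen (SphereFace F (some v)) a (some b) := by
      rintro v (_ | a) ha
      · obtain ⟨i, hi⟩ := graph_adj_none.mp ha.symm
        obtain rfl := Option.some.inj hi
        exact ⟨.inl (i + 1), inl_adj t (Fin.ne_add_one i),
          .rel _ _ (Or.inr ⟨i, Or.inr (Or.inr ⟨rfl, rfl, rfl⟩)⟩)⟩
      · exact ⟨a, graph_adj_some.mp ha, .refl _⟩
    rintro (_ | v) a b ha hb
    · obtain ⟨i, rfl⟩ := graph_adj_none.mp ha
      obtain ⟨j, rfl⟩ := graph_adj_none.mp hb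
      exact hnone' i j
    · obtain ⟨a', ha', h1⟩ := key ha
      obtain ⟨b', hb', h2⟩ := key hb
      exact .trans _ _ _ h1 (.trans _ _ _ (hsome (hF.link ha' hb')) (.symm _ _ h2))

theorem isTriangulation_graph (t : SierpinskiTree) : IsTriangulation t.graph := by
  obtain ⟨F, hF⟩ := t.exists_isOrientedDisk
  refine (isOrientedTriangulation_sphereFace hF).isTriangulation t.connected_graph ?_ ?_
  · rw [natCard_vertex]
    omega
  · rw [card_edgeSet_graph, natCard_vertex]
    omega

/-! ### Separating triangles of the Sierpiński-like graph -/

theorem IsRegion.cuts {D : Finset t.Disk} {A : Set t.Disk} (h : t.IsRegion D A) :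
    t.graph.Cuts (D.map Function.Embedding.some) (some '' A) where
  nonempty := h.nonempty.image _
  disjoint := by
    rintro _ ⟨a, ha, rfl⟩ hD
    exact h.disjoint a ha ((Finset.mem_map' Function.Embedding.some).mp hD)
  rest := by
    refine ⟨none, ?_, ?_⟩
    · rintro ⟨a, -, ha⟩
      cases ha
    · simp
  closed := by
    rintro _ ⟨a, ha, rfl⟩ (_ | x) hx
    · obtain ⟨i, hi⟩ := graph_adj_none.mp hx.symm
      obtain ⟨y, hy⟩ := h.interior ha
      rw [← hy] at hi
      cases Option.some.inj hi
    · exact (h.closed a ha x (graph_adj_some.mp hx)).imp (fun h => ⟨x, h, rfl⟩)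
        (Finset.mem_map' Function.Embedding.some).mpr

/-- The exterior is one component because every exterior vertex reaches some outer corner outside
`D`, and all outer corners are adjacent to `none`. -/
theorem IsRegion.isSeparatingTriangle {D : Finset t.Disk} {A : Set t.Disk} (h : t.IsRegion D A) :
    IsSeparatingTriangle t.graph (D.map Function.Embedding.some) := by
  have hsome : ∀ {a b}, t.diskGraph.Adj a b → t.graph.Adj (some a) (some b) := graph_adj_some.mpr
  have hS : ∀ x, x ∉ A → x ∉ D →
      some x ∉ some '' A ∧ (some x : t.Vertex) ∉ D.map Function.Embedding.some := by
    intro x hA hD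
    refine ⟨?_, fun hx => hD ((Finset.mem_map' Function.Embedding.some).mp hx)⟩
    rintro ⟨y, hy, hyx⟩
    exact hA (Option.some.inj hyx ▸ hy)
  have hnone : (none : t.Vertex) ∉ some '' A ∧ none ∉ D.map Function.Embedding.some := by
    simp
  refine ⟨⟨?_, by rw [Finset.card_map, h.isNClique.card_eq]⟩,
    h.cuts.card_connectedComponent ?_ hnone ?_⟩
  · rw [Finset.coe_map]
    rintro _ ⟨x, hx, rfl⟩ _ ⟨y, hy, rfl⟩ hxy
    exact hsome (h.isNClique.isClique hx hy fun e => hxy (congrArg _ e))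
  · rintro _ ⟨a, ha, rfl⟩ _ ⟨b, hb, rfl⟩
    exact SimpleGraph.within_reachable_map (h.inner a ha b hb) some hsome fun x hx => ⟨x, hx, rfl⟩
  · rintro (_ | x) hA hD
    · exact .refl _
    · obtain ⟨k, hkD, hk⟩ := h.outer x (fun hx => hA ⟨x, hx, rfl⟩)
        fun hx => hD ((Finset.mem_map' Function.Embedding.some).mpr hx)
      refine (SimpleGraph.within_reachable_map hk some hsome fun y hy => hS y hy.1 hy.2).trans
        (SimpleGraph.Adj.reachable ⟨hS _ (fun hkA => ?_) hkD, hnone,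
          (graph_adj_none.mpr ⟨k, rfl⟩).symm⟩)
      obtain ⟨y, hy⟩ := h.interior hkA
      cases hy

/-! ### Patterns with a given number of vertices -/

/-- The number of inserted triangles in `k` full levels of recursion. -/
def fullNodes : ℕ → ℕ
  | 0 => 0
  | k + 1 => 3 * fullNodes k + 1

/-- Here `m` counts inserted triangles. Each insertion replaces one stopping vertex by three
inserted and three stopping ones, a gain of five. -/
theorem exists_hasLevels_of_between (k m : ℕ) (h1 : fullNodes k ≤ m) (h2 : m ≤ fullNodes (k + 1)) :
    ∃ t : SierpinskiTree, t.HasLevels k ∧ Nat.card t.Interior = 5 * m + 1 := by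
  have hleaf : Nat.card leaf.Interior = 1 := by
    change Nat.card Unit = 1
    simp
  induction k generalizing m with
  | zero =>
    simp only [fullNodes] at h2
    rcases m with _ | m
    · exact ⟨leaf, trivial, hleaf⟩
    · refine ⟨node fun _ => leaf, fun _ => rfl, ?_⟩
      rw [card_interior_node, Fin.sum_univ_three, hleaf]
      omega
  | succ k ih =>
    simp only [fullNodes] at h1 h2 ih
    -- The remaining `m - 1` insertions are shared as evenly as possible: `(m - 1 + i) / 3` for `i =
    -- 0, 1, 2` sum to `m - 1`, and each stays within the bounds for level `k`.
    have hpart : ∀ i : Fin 3, ∃ t : SierpinskiTree, t.HasLevels k ∧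
        Nat.card t.Interior = 5 * ((m - 1 + i) / 3) + 1 := by
      intro i
      have := i.isLt
      exact ih _ (by omega) (by omega)
    choose c hc hcard using hpart
    refine ⟨node c, hc, ?_⟩
    rw [card_interior_node, Fin.sum_univ_three, hcard, hcard, hcard]
    simp only [Fin.val_zero, Fin.val_one, Fin.val_two]
    omega

theorem exists_hasLevels (m : ℕ) :
    ∃ (k : ℕ) (t : SierpinskiTree), t.HasLevels k ∧ Nat.card t.Interior = 5 * m + 1 := by
  obtain ⟨k, h1, h2⟩ : ∃ k, fullNodes k ≤ m ∧ m ≤ fullNodes (k + 1) := by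
    induction m with
    | zero => exact ⟨0, le_rfl, Nat.zero_le _⟩
    | succ m ih =>
      obtain ⟨k, h1, h2⟩ := ih
      by_cases h : m + 1 ≤ fullNodes (k + 1)
      · exact ⟨k, by omega, h⟩
      · refine ⟨k + 1, by omega, ?_⟩
        rw [fullNodes]
        omega
  exact ⟨k, exists_hasLevels_of_between k m h1 h2⟩

end SierpinskiTree

/-! ### The extremal graphs on `5 (q + 1)` vertices -/

theorem mainTheorem6 (n : ℕ) (hn : 0 < n) (h5 : 5 ∣ n) :
    ((3 * (n : ℚ) - 10) / 5 = ⌊(3 * (n : ℚ) - 9) / 5⌋) ∧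
    ∃ (k : ℕ) (t : SierpinskiTree), t.HasLevels k ∧
      Nat.card t.Vertex = n ∧
      IsTriangulation t.graph ∧
      (∃ 𝒟 : Finset (Finset t.Vertex),
        (𝒟.card : ℚ) = (3 * (n : ℚ) - 10) / 5 ∧
        (∀ D ∈ 𝒟, IsSeparatingTriangle t.graph D) ∧
        (∀ D ∈ 𝒟, ∀ D' ∈ 𝒟, D ≠ D' →
          Disjoint (triangleEdges t.graph D) (triangleEdges t.graph D'))) ∧
      (∀ (m : ℕ) (H : SimpleGraph t.Vertex),
        FlipsTo m t.graph H → IsVertexConnected 4 H →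
          (3 * (n : ℚ) - 10) / 5 ≤ (m : ℚ)) := by
  classical
  obtain ⟨q, rfl⟩ := h5
  obtain ⟨q, rfl⟩ : ∃ m, q = m + 1 := ⟨q - 1, by omega⟩
  have hval : (3 * ((5 * (q + 1) : ℕ) : ℚ) - 10) / 5 = ((3 * q + 1 : ℕ) : ℚ) := by
    push_cast
    ring
  constructor
  · have hfloor : ⌊(3 * ((5 * (q + 1) : ℕ) : ℚ) - 9) / 5⌋ = ((3 * q + 1 : ℕ) : ℤ) := by
      rw [Int.floor_eq_iff]
      push_cast
      constructor <;> linarith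
    rw [hfloor, hval]
    norm_cast
  obtain ⟨k, t, ht, hcard⟩ := SierpinskiTree.exists_hasLevels q
  obtain ⟨ι, _, D, hι, hreg, hdisj⟩ := t.exists_regions
  choose A hA using hreg
  let T : ι → Finset t.Vertex := fun p => (D p).map Function.Embedding.some
  have hT : ∀ p q, p ≠ q → ∀ a ∈ T p, ∀ b ∈ T p, a ∈ T q → b ∈ T q → a = b := by
    intro p q hpq a ha b hb ha' hb'
    obtain ⟨x, hx, rfl⟩ := Finset.mem_map.mp ha
    obtain ⟨y, hy, rfl⟩ := Finset.mem_map.mp hb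
    rw [Finset.mem_map'] at ha' hb'
    rw [hdisj p q hpq x hx y hy ha' hb']
  have hT3 : ∀ p, (T p).card = 3 := fun p => by
    rw [Finset.card_map, (hA p).isNClique.card_eq]
  -- Equal triangles with different indices would share three vertices, while at most one is
  -- allowed.
  have hinj : Function.Injective T := by
    intro p q hpq
    by_contra hne
    obtain ⟨a, ha, b, hb, hab⟩ := Finset.one_lt_card.mp (by rw [hT3 p]; norm_num)
    exact hab (hT p q hne a ha b hb (hpq ▸ ha) (hpq ▸ hb))
  have hTcard : (Finset.univ.image T).card = 3 * q + 1 := by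
    rw [Finset.card_image_of_injective _ hinj, Finset.card_univ]
    omega
  have hpair : ∀ E ∈ Finset.univ.image T, ∀ E' ∈ Finset.univ.image T, E ≠ E' →
      ∀ a ∈ E, ∀ b ∈ E, a ∈ E' → b ∈ E' → a = b := by
    intro E hE E' hE' hne
    obtain ⟨p, -, rfl⟩ := Finset.mem_image.mp hE
    obtain ⟨q, -, rfl⟩ := Finset.mem_image.mp hE'
    exact hT p q fun h => hne (congrArg T h)
  refine ⟨k, t, ht, ?_, t.isTriangulation_graph, ⟨Finset.univ.image T, ?_, ?_, ?_⟩, ?_⟩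
  · rw [SierpinskiTree.natCard_vertex, hcard]
    ring
  · rw [hTcard, hval]
  · intro E hE
    obtain ⟨p, -, rfl⟩ := Finset.mem_image.mp hE
    exact (hA p).isSeparatingTriangle
  · intro E hE E' hE' hne
    rw [Set.disjoint_left]
    rintro e ⟨he, heE⟩ ⟨-, heE'⟩
    induction e with | _ a b
    exact (SimpleGraph.mem_edgeSet _ |>.mp he).ne (hpair E hE E' hE' hne a (heE a (Sym2.mem_mk_left _ _))
      b (heE b (Sym2.mem_mk_right _ _)) (heE' a (Sym2.mem_mk_left _ _))
      (heE' b (Sym2.mem_mk_right _ _)))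
  · intro m H hf hH
    rw [hval, ← hTcard]
    refine Nat.cast_le.mpr (hf.card_le hH _ ?_ ?_ hpair)
    · intro E hE
      obtain ⟨p, -, rfl⟩ := Finset.mem_image.mp hE
      exact hT3 p
    · intro E hE
      obtain ⟨p, -, rfl⟩ := Finset.mem_image.mp hE
      exact ⟨_, (hA p).cuts⟩
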